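/- **Notation.** Let $a\ge 1$ be an integer which is either equal to $1$ or is not a perfect power $b^m$ ($m\ge 2$) of a rational number $b$. For $N\ge 1$ let $\mathbb{Q}_a(N)\subset\mathbb{C}$ be the field generated over $\mathbb{Q}$ by all roots of $X^N-a$. For a finite extension $L/K$ of number fields, the discriminant $\mathrm{disc}_{L/K}$ of a finite family $(x_s)$ in $L$ is $\det(\mathrm{Tr}_{L/K}(x_sx_t))_{s,t}$. Let $N=p_1^{e_1}\cdots p_s^{e_s}$ with primes $p_1<\dots<p_s$. For $1\le i\le s$, $1\le t\le e_i$ put $m_{i,t}=p_1^{e_1}\cdots p_{i-1}^{e_{i-1}}p_i^{t}$ and $m_{i,0}=p_1^{e_1}\cdots p_{i-1}^{e_{i-1}}$. If $a>1$, define $$\Delta_a(N)=\Bigl|\mathrm{Nm}_{\mathbb{Q}_a(N)|\mathbb{Q}}\Bigl(\prod_{i=1}^{s}\prod_{t=1}^{e_i}\mathrm{disc}_{\mathbb{Q}_a(m_{i,t})/\mathbb{Q}_a(m_{i,t-1})}\bigl\{\zeta_{p_i^t}^{\,l}\,a^{n/p_i^t}\bigr\}_{l,n}\Bigr)\Bigr|,$$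 where $\zeta_m=e^{2\pi i/m}$, $a^{1/m}>0$, $0\le n<p_i$, and $0\le l<p_i-1$ if $t=1$, $0\le l<p_i$ if $t\ge 2$. If $a=1$, put $\Delta_1(N)=1$. For $\beta\in\mathbb{Q}_a(N)$ let $M_{a,N}(\beta)$ be the least number of summands, counted with repetition, in a representation of $\Delta_a(N)\beta$ as a sum of numbers of the form $\xi\,a^{j/N}$ with $\xi$ a root of unity and $0\le j<N$. For $k>0$ and $c_1>1$ let $g(t)=t\exp\bigl(-k\log t'/\log\log t'\bigr)$ with $t'=t+c_1$. The constant $c_1=c_1(k)$ is fixed so that $\log\log c_1\ge 2$ and $g'(t)\ge 0$, $g''(t)\le 0$ for all $t\ge 0$. **Theorem 4.4.** Let $k>\log 2$, and let $c_1$ be any constant as above. There is a positive number $c_5$, depending only on $k$ (and on the choice of $c_1=c_1(k)$), with the following property. Let $a$ be as above, let $N=pN_1$ with $p\ge c_5$ prime and $p\nmid N_1$, $N_1\ge 1$, let $\zeta$ be a primitive $p$-th root of unity and $\sqrt[p]{a}$ any complex $p$-th root of $a$, and write $\sqrt[p]{a^j}=(\sqrt[p]{a})^j$. Let $$\beta=\sum_{0\le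 i,j\le p-1}a_{ij}\,\zeta^i\sqrt[p]{a^j},\qquad a_{ij}=\alpha_{ij}\,r,$$ where the $\alpha_{ij}$ are algebraic integers in $\mathbb{Q}_a(N_1)$ and $$r=\Bigl|\mathrm{Nm}_{\mathbb{Q}_a(N)|\mathbb{Q}}\bigl(\mathrm{disc}_{\mathbb{Q}_a(N)/\mathbb{Q}_a(N_1)}\{\zeta^i\sqrt[p]{a^j}\}_{0\le i\le p-2,\ 0\le j\le p-1}\bigr)\Bigr|^{-1}\ \text{ if } a>1,\qquad r=1\ \text{ if } a=1$$ (if the discriminant is $0$, that is, if these elements are linearly dependent over $\mathbb{Q}_a(N_1)$, read $r=0$). If $M_{a,N}(\beta)=0$ or $\log M_{a,N}(\beta)\le p(p-1)$, then $$\sum_{0\le i,j,l,m\le p-1} g\bigl(M_{a,N_1}(\alpha_{ij}-\alpha_{lm})\bigr)\ \ge\ 2p(p-1)\,g\bigl(M_{a,N}(\beta)\bigr).$$ -/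

import Mathlib

noncomputable section

/-- The field `ℚ_a(N)`, generated over `ℚ` (inside `ℂ`) by all roots of `X ^ N - a`. -/
def kummerField (a N : ℕ) : IntermediateField ℚ ℂ :=
  IntermediateField.adjoin ℚ {z : ℂ | z ^ N = (a : ℂ)}

theorem kummerField_le {a m N : ℕ} (hN : N ≠ 0) (h : m ∣ N) :
    kummerField a m ≤ kummerField a N := by
  obtain ⟨d, rfl⟩ := h
  have hd : d ≠ 0 := fun h => hN (by simp [h])
  refine IntermediateField.adjoin_le_iff.2 fun z hz => ?_
  obtain ⟨w, rfl⟩ := IsAlgClosed.exists_pow_nat_eq z (Nat.pos_of_ne_zero hd)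
  refine pow_mem (IntermediateField.subset_adjoin ℚ _ ?_) d
  have hz' : (w ^ d) ^ m = (a : ℂ) := hz
  show w ^ (m * d) = (a : ℂ)
  rw [mul_comm, pow_mul, hz']

theorem mem_kummerField_of_pow_eq {a m N : ℕ} (hN : N ≠ 0) (h : m ∣ N) {z : ℂ}
    (hz : z ^ m = (a : ℂ)) : z ∈ kummerField a N :=
  kummerField_le hN h (IntermediateField.subset_adjoin ℚ _ hz)

theorem mem_kummerField_of_pow_eq_one {a m N : ℕ} (ha : a ≠ 0) (hN : N ≠ 0) (h : m ∣ N)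
    {z : ℂ} (hz : z ^ m = 1) : z ∈ kummerField a N := by
  have hm : m ≠ 0 := fun h0 => hN (by simpa [h0] using h)
  obtain ⟨w, hw⟩ := IsAlgClosed.exists_pow_nat_eq (a : ℂ) (Nat.pos_of_ne_zero hm)
  have hw0 : w ≠ 0 := by
    rintro rfl
    rw [zero_pow hm] at hw
    exact ha (by exact_mod_cast hw.symm)
  have h1 := mem_kummerField_of_pow_eq hN h hw
  have h2 : z * w ∈ kummerField a N :=
    mem_kummerField_of_pow_eq hN h (by rw [mul_pow, hz, hw, one_mul])
  have h3 := div_mem h2 h1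
  rwa [mul_div_assoc, div_self hw0, mul_one] at h3

/-- The positive real number `a ^ (j / N)`, as a complex number. -/
def realRoot (a N j : ℕ) : ℂ := (((a : ℝ) ^ ((j : ℝ) / (N : ℝ)) : ℝ) : ℂ)

theorem realRoot_one_pow {a N : ℕ} (hN : N ≠ 0) : realRoot a N 1 ^ N = (a : ℂ) := by
  have h : (((a : ℝ) ^ (((1 : ℕ) : ℝ) / (N : ℝ)) : ℝ)) ^ N = (a : ℝ) := by
    rw [Nat.cast_one, one_div, Real.rpow_inv_natCast_pow (Nat.cast_nonneg a) hN]
  unfold realRoot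
  rw [← Complex.ofReal_pow, h, Complex.ofReal_natCast]

/-- The standard primitive `m`-th root of unity. -/
def stdRoot (m : ℕ) : ℂ := Complex.exp (2 * Real.pi * Complex.I / m)

theorem stdRoot_pow {m : ℕ} (hm : m ≠ 0) : stdRoot m ^ m = 1 :=
  (Complex.isPrimitiveRoot_exp m hm).pow_eq_one

/-- The relative discriminant, for the extension `L / K`, of the family
`z ^ i * w ^ j` with `0 ≤ i < r` and `0 ≤ j < q`. -/
def relDisc (K L : IntermediateField ℚ ℂ) (h : K ≤ L) (r q : ℕ) (z w : L) : K :=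
  Algebra.discr K (fun x : Fin r × Fin q =>
    (⟨((z ^ (x.1 : ℕ) * w ^ (x.2 : ℕ) : L) : ℂ), (z ^ (x.1 : ℕ) * w ^ (x.2 : ℕ)).2⟩ :
      IntermediateField.extendScalars h))

/-- For `N = p₁ ^ e₁ * ⋯ * pₛ ^ eₛ` with `p₁ < ⋯ < pₛ` and `q = pᵢ`, the partial product
`p₁ ^ e₁ * ⋯ * pᵢ₋₁ ^ eᵢ₋₁ * pᵢ ^ t`. -/
def towerIndex (N q t : ℕ) : ℕ :=
  q ^ t * ∏ r ∈ N.primeFactors with r < q, r ^ N.factorization r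

theorem towerIndex_succ (N q t : ℕ) : towerIndex N q (t + 1) = q * towerIndex N q t := by
  unfold towerIndex; ring

theorem towerIndex_dvd {N q t : ℕ} (hq : q ∈ N.primeFactors) (ht : t ≤ N.factorization q) :
    towerIndex N q t ∣ N := by
  have hN : N ≠ 0 := (Nat.mem_primeFactors.1 hq).2.2
  have h1 : q ^ t * ∏ r ∈ N.primeFactors with r < q, r ^ N.factorization r ∣
      q ^ N.factorization q * ∏ r ∈ N.primeFactors with r < q, r ^ N.factorization r :=
    Nat.mul_dvd_mul_right (pow_dvd_pow q ht) _
  have hnot : q ∉ N.primeFactors.filter (fun r => r < q) := by simp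
  rw [← Finset.prod_insert (f := fun r => r ^ N.factorization r) hnot] at h1
  refine h1.trans ?_
  have h2 : (∏ r ∈ N.primeFactors, r ^ N.factorization r) = N :=
    Nat.prod_factorization_pow_eq_self hN
  conv_rhs => rw [← h2]
  refine Finset.prod_dvd_prod_of_subset _ _ _ ?_
  intro x hx
  rcases Finset.mem_insert.1 hx with rfl | hx
  · exact hq
  · exact (Finset.mem_filter.1 hx).1

theorem towerIndex_ne_zero {N q t : ℕ} (hq : q ∈ N.primeFactors)
    (ht : t ≤ N.factorization q) : towerIndex N q t ≠ 0 :=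
  ne_zero_of_dvd_ne_zero (Nat.mem_primeFactors.1 hq).2.2 (towerIndex_dvd hq ht)

theorem pow_dvd_towerIndex (N q t : ℕ) : q ^ t ∣ towerIndex N q t := Dvd.intro _ rfl

theorem towerIndex_dvd_succ (N q t : ℕ) : towerIndex N q t ∣ towerIndex N q (t + 1) :=
  ⟨q, by rw [towerIndex_succ, mul_comm]⟩

/-- The discriminant of one step of the tower: the one of `ℚ_a(⋯ q ^ (t + 1)) / ℚ_a(⋯ q ^ t)`
with respect to the elements `ζ ^ l * b ^ k`, where `ζ` is the standard primitive
`q ^ (t + 1)`-th root of unity, `b` the positive real `q ^ (t + 1)`-th root of `a`,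
`0 ≤ k < q`, and `0 ≤ l < q - 1` if `t = 0` (first power of a new prime), `0 ≤ l < q` otherwise. -/
def stepDisc (a N : ℕ) [NeZero a] (q : N.primeFactors) (t : Fin (N.factorization q)) :
    kummerField a (towerIndex N q t) :=
  relDisc (kummerField a (towerIndex N q t)) (kummerField a (towerIndex N q (t + 1)))
    (kummerField_le (towerIndex_ne_zero q.2 t.2) (towerIndex_dvd_succ N q t))
    (if (t : ℕ) = 0 then (q : ℕ) - 1 else q) q
    ⟨stdRoot ((q : ℕ) ^ ((t : ℕ) + 1)), mem_kummerField_of_pow_eq_one (NeZero.ne a)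
      (towerIndex_ne_zero q.2 t.2) (pow_dvd_towerIndex N q (t + 1))
      (stdRoot_pow (pow_ne_zero _ (Nat.mem_primeFactors.1 q.2).1.ne_zero))⟩
    ⟨realRoot a ((q : ℕ) ^ ((t : ℕ) + 1)) 1, mem_kummerField_of_pow_eq
      (towerIndex_ne_zero q.2 t.2) (pow_dvd_towerIndex N q (t + 1))
      (realRoot_one_pow (pow_ne_zero _ (Nat.mem_primeFactors.1 q.2).1.ne_zero))⟩

/-- The number `Δ_a(N)`: the absolute value of the norm from `ℚ_a(N)` to `ℚ` of the product of
the discriminants of all steps of the tower; for `a = 1` it is replaced by `1`. -/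
def kummerDelta (a N : ℕ) [NeZero a] : ℚ :=
  if a = 1 then 1 else
    |Algebra.norm ℚ (∏ q : N.primeFactors, ∏ t : Fin (N.factorization q),
      IntermediateField.inclusion
        (kummerField_le (Nat.mem_primeFactors.1 q.2).2.2 (towerIndex_dvd q.2 t.2.le))
        (stepDisc a N q t))|

/-- `z` is a root of unity times one of the positive real numbers `a ^ (j / N)`, `0 ≤ j < N`. -/
def IsRootTerm (a N : ℕ) (z : ℂ) : Prop :=
  ∃ (ξ : ℂ) (m j : ℕ), 0 < m ∧ ξ ^ m = 1 ∧ j < N ∧ z = ξ * realRoot a N j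

/-- `M_{a,N}(β)`: the least number of summands, counted with repetition, in a representation
of `Δ_a(N) * β` as a sum of terms `ξ * a ^ (j / N)` with `ξ` a root of unity. -/
def kummerLength (a N : ℕ) [NeZero a] (β : ℂ) : ℕ :=
  sInf {n : ℕ | ∃ z : Fin n → ℂ, (∀ i, IsRootTerm a N (z i)) ∧
    ∑ i, z i = ((kummerDelta a N : ℚ) : ℂ) * β}

/-- The number `r = 1 / |Nm (disc {ζ ^ i * ρ ^ j})|`, where the discriminant is the one of
`ℚ_a(p * N₁) / ℚ_a(N₁)` with respect to `ζ ^ i * ρ ^ j`, `0 ≤ i < p - 1`, `0 ≤ j < p`,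
and the norm is from `ℚ_a(p * N₁)` to `ℚ`; for `a = 1` it is replaced by `1`. -/
def kummerScale (a p N₁ : ℕ) [NeZero a] (hN : p * N₁ ≠ 0) (ζ ρ : ℂ)
    (hζ : IsPrimitiveRoot ζ p) (hρ : ρ ^ p = (a : ℂ)) : ℚ :=
  if a = 1 then 1 else
    1 / |Algebra.norm ℚ (IntermediateField.inclusion
      (kummerField_le (a := a) hN (Dvd.intro_left p rfl))
      (relDisc (kummerField a N₁) (kummerField a (p * N₁))
        (kummerField_le hN (Dvd.intro_left p rfl)) (p - 1) p
        ⟨ζ, mem_kummerField_of_pow_eq_one (NeZero.ne a) hN (Dvd.intro N₁ rfl) hζ.pow_eq_one⟩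
        ⟨ρ, mem_kummerField_of_pow_eq hN (Dvd.intro N₁ rfl) hρ⟩))|

/-- The auxiliary function `g(t) = t * exp (-k * log t' / log (log t'))`, `t' = t + c₁`. -/
def loxtonG (k c₁ t : ℝ) : ℝ :=
  t * Real.exp (-k * Real.log (t + c₁) / Real.log (Real.log (t + c₁)))

/-- The conditions on the constant `c₁` in the definition of `g`: `log log c₁ ≥ 2`, and
`g' ≥ 0`, `g'' ≤ 0` on `[0, ∞)`. -/
def IsLoxtonConst (k c₁ : ℝ) : Prop :=
  1 < c₁ ∧ 2 ≤ Real.log (Real.log c₁) ∧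
    ∀ t : ℝ, 0 ≤ t → 0 ≤ deriv (loxtonG k c₁) t ∧ deriv (deriv (loxtonG k c₁)) t ≤ 0

end

/-! Write T = M(β), Δ = Δ_a(N), and Δβ = Δr·β' with β' = ∑ α_ij ζ^i ρ^j. If T = 0 the claim is
trivial, because g(0) = 0 ≤ g. Otherwise Δr·β' ≠ 0, and there are two cases.

If a ≠ 1 and N₁ ≠ 1, the bound on log T cannot hold. A nonzero discriminant of a first step at p is
one fixed integer whatever the base field (`relDisc_eq_intCast`), so r cancels the factor of p in Δ.
A prime dividing N₁ still contributes, and Δr ≥ (4a)^(p(p-1))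
(`four_mul_pow_le_kummerDelta_mul_kummerScale`). Some conjugate of the algebraic integer β' has
absolute value at least 1, whereas all conjugates of ξ a^(j/N) are bounded by a. Hence Δr ≤ aT
(`IsRootSum.le_mul`), so T ≥ 4^(p(p-1)) > e^(p(p-1)).

If a = 1 or N₁ = 1, then Δ_a(N₁) = Δr = 1. The lengths m(s,t) of α_s - α_t are symmetric and satisfy
the triangle inequality. Since ∑ ζ^i ρ^j = 0, any α_s may be subtracted from all coefficients, so T
≤ ∑_t m(s,t) for every s (`kummerLength_le_sum`). What remains is a statement about such an m on p²
points (`exists_loxtonG_sum_bound`). As g(t)/t decreases, every row sum of g(m) is at least g(T),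
which falls short by a factor of about 2. To recover it, fix a point o of least row sum. Points near
o gain a factor e^l > 2 from the decay of g(t)/t, and this is where k > log 2 enters. Points far
from o are few, and the triangle inequality counts their distances twice (`le_sum_sum_of_metric`).
-/

/-! ### Growth of g: monotonicity, decay of g(t)/t, subadditivity -/

/-- The function u / log u has derivative 1/log u - 1/log² u, which decreases once log u ≥ 2. The
increment is therefore at least (u - v) times the derivative at u, and replacing log u by L only
lowers it. -/
theorem div_log_sub_div_log {v u L : ℝ} (hv : Real.exp 2 ≤ v) (hvu : v ≤ u)
    (hL : Real.log u ≤ L) :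
    (u - v) * (1 / L - 1 / L ^ 2) ≤ u / Real.log u - v / Real.log v := by
  have hv0 : 0 < v := (Real.exp_pos 2).trans_le hv
  have hu0 : 0 < u := hv0.trans_le hvu
  obtain ⟨B, hB⟩ : ∃ B, B = Real.log v := ⟨_, rfl⟩
  obtain ⟨A, hA⟩ : ∃ A, A = Real.log u := ⟨_, rfl⟩
  have hB2 : 2 ≤ B := by rw [hB]; exact (Real.le_log_iff_exp_le hv0).2 hv
  have hAB : B ≤ A := by rw [hA, hB]; exact Real.log_le_log hv0 hvu
  have hu : u = v * Real.exp (A - B) := by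
    rw [hA, hB, ← Real.log_div hu0.ne' hv0.ne', Real.exp_log (div_pos hu0 hv0)]
    field_simp
  rw [← hA] at hL
  rw [← hA, ← hB]
  have hA0 : 0 < A := by linarith
  have hB0 : 0 < B := by linarith
  have hL0 : 0 < L := by linarith
  have h1 : 1 / L - 1 / L ^ 2 ≤ 1 / A - 1 / A ^ 2 := by
    have e : (1 / A - 1 / A ^ 2) - (1 / L - 1 / L ^ 2) =
        (L - A) * (L * A - L - A) / (A ^ 2 * L ^ 2) := by
      field_simp; ring
    have : 0 ≤ (L - A) * (L * A - L - A) / (A ^ 2 * L ^ 2) := by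
      apply div_nonneg (mul_nonneg (by linarith) (by nlinarith)) (by positivity)
    linarith
  -- With u = v e^(A-B), concavity reduces to the quadratic lower bound for exp, and B ≥ 2 absorbs
  -- the denominator.
  have h2 : 1 + (A - B) + (A - B) ^ 2 / 2 ≤ Real.exp (A - B) :=
    Real.quadratic_le_exp_of_nonneg (by linarith)
  have h3 : (A - B) + (A - B) ^ 2 / B ≤ Real.exp (A - B) - 1 := by
    have : (A - B) ^ 2 / B ≤ (A - B) ^ 2 / 2 := by gcongr
    linarith
  calc (u - v) * (1 / L - 1 / L ^ 2) ≤ (u - v) * (1 / A - 1 / A ^ 2) :=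
        mul_le_mul_of_nonneg_left h1 (by linarith)
    _ ≤ u / A - v / B := by
      have e : u / A - v / B - (u - v) * (1 / A - 1 / A ^ 2) =
          v / A ^ 2 * ((Real.exp (A - B) - 1) - ((A - B) + (A - B) ^ 2 / B)) := by
        rw [hu]; field_simp; ring
      have : 0 ≤ v / A ^ 2 * ((Real.exp (A - B) - 1) - ((A - B) + (A - B) ^ 2 / B)) :=
        mul_nonneg (by positivity) (by linarith)
      linarith

section Loxton

variable {k c₁ : ℝ}

theorem exp_two_le_log_of_two_le_log_log {c : ℝ} (hc : 1 < c)
    (h : 2 ≤ Real.log (Real.log c)) : Real.exp 2 ≤ Real.log c :=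
  (Real.le_log_iff_exp_le (Real.log_pos hc)).1 h

theorem IsLoxtonConst.exp_two_le_log (hc : IsLoxtonConst k c₁) {t : ℝ} (ht : 0 ≤ t) :
    Real.exp 2 ≤ Real.log (t + c₁) :=
  (exp_two_le_log_of_two_le_log_log hc.1 hc.2.1).trans
    (Real.log_le_log (by linarith [hc.1]) (by linarith))

theorem loxtonG_nonneg {t : ℝ} (ht : 0 ≤ t) : 0 ≤ loxtonG k c₁ t :=
  mul_nonneg ht (Real.exp_pos _).le

theorem loxtonG_pos {t : ℝ} (ht : 0 < t) : 0 < loxtonG k c₁ t :=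
  mul_pos ht (Real.exp_pos _)

theorem loxtonG_zero : loxtonG k c₁ 0 = 0 := by simp [loxtonG]

theorem IsLoxtonConst.monotoneOn (hc : IsLoxtonConst k c₁) :
    MonotoneOn (loxtonG k c₁) (Set.Ici 0) := by
  have hd : ∀ t : ℝ, 0 ≤ t → DifferentiableAt ℝ (loxtonG k c₁) t := by
    intro t ht
    have h1 : t + c₁ ≠ 0 := by linarith [hc.1]
    have h2 : 1 < Real.log (t + c₁) := by
      have := hc.exp_two_le_log ht
      have := Real.add_one_le_exp (2 : ℝ)
      linarith
    have h3 : Real.log (Real.log (t + c₁)) ≠ 0 := (Real.log_pos h2).ne'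
    have h4 : Real.log (t + c₁) ≠ 0 := by linarith
    unfold loxtonG
    fun_prop (disch := assumption)
  refine monotoneOn_of_deriv_nonneg (convex_Ici 0) ?_ ?_ ?_
  · exact fun t ht => (hd t ht).continuousAt.continuousWithinAt
  · exact fun t ht => (hd t (interior_subset ht)).differentiableWithinAt
  · exact fun t ht => (hc.2.2 t (interior_subset ht)).1

/-- Quantitative decay of g(t)/t from m to T, by the previous estimate with u = log(T + c₁), v =
log(m + c₁). Allowing any bound L for log log(T + c₁) makes the gain uniform in T. -/
theorem IsLoxtonConst.mul_exp_le (hc : IsLoxtonConst k c₁) (hk : 0 ≤ k) {m T L : ℝ}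
    (hm : 0 ≤ m) (hmT : m ≤ T) (hL : Real.log (Real.log (T + c₁)) ≤ L) :
    m * loxtonG k c₁ T * Real.exp (k * ((Real.log (T + c₁) - Real.log (m + c₁)) *
      (1 / L - 1 / L ^ 2))) ≤ T * loxtonG k c₁ m := by
  have h := div_log_sub_div_log (hc.exp_two_le_log hm)
    (Real.log_le_log (by linarith [hc.1]) (by linarith : m + c₁ ≤ T + c₁)) hL
  unfold loxtonG
  rw [show ∀ x y : ℝ, m * (T * x) * y = (m * T) * (x * y) by intros; ring,
    show ∀ z : ℝ, T * (m * z) = (m * T) * z by intros; ring, ← Real.exp_add]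
  refine mul_le_mul_of_nonneg_left (Real.exp_le_exp.2 ?_) (mul_nonneg hm (hm.trans hmT))
  have h' := mul_le_mul_of_nonneg_left h hk
  rw [mul_div_assoc, mul_div_assoc]
  linarith

theorem IsLoxtonConst.mul_le (hc : IsLoxtonConst k c₁) (hk : 0 ≤ k) {m T : ℝ}
    (hm : 0 ≤ m) (hmT : m ≤ T) : m * loxtonG k c₁ T ≤ T * loxtonG k c₁ m := by
  have hl : Real.log (m + c₁) ≤ Real.log (T + c₁) :=
    Real.log_le_log (by linarith [hc.1]) (by linarith)
  have h0 : Real.exp 2 ≤ Real.log (T + c₁) := hc.exp_two_le_log (hm.trans hmT)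
  have h2 : 2 ≤ Real.log (Real.log (T + c₁)) :=
    (Real.le_log_iff_exp_le ((Real.exp_pos 2).trans_le h0)).2 h0
  refine le_trans ?_ (hc.mul_exp_le hk hm hmT le_rfl)
  refine le_mul_of_one_le_right (mul_nonneg hm (loxtonG_nonneg (hm.trans hmT)))
    (Real.one_le_exp (mul_nonneg hk (mul_nonneg (by linarith) ?_)))
  rw [sub_nonneg]
  exact one_div_le_one_div_of_le (by linarith) (by nlinarith)

/-- Since g(t)/t decreases, g(s) and g(t) are at least the shares s/(s+t) and t/(s+t) of g(s+t). -/
theorem IsLoxtonConst.add_le (hc : IsLoxtonConst k c₁) (hk : 0 ≤ k) {s t : ℝ}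
    (hs : 0 ≤ s) (ht : 0 ≤ t) :
    loxtonG k c₁ (s + t) ≤ loxtonG k c₁ s + loxtonG k c₁ t := by
  rcases (add_nonneg hs ht).eq_or_lt with h | h
  · have : s = 0 := by linarith
    have : t = 0 := by linarith
    subst_vars; simp [loxtonG_zero]
  · have h1 := hc.mul_le hk hs (by linarith : s ≤ s + t)
    have h2 := hc.mul_le hk ht (by linarith : t ≤ s + t)
    nlinarith

end Loxton

/-! ### The combinatorial inequality for a metric on a finite set -/

/-- Here d = g(m), G = g(T), and x is m truncated at T and divided by T. The points are split by
their distance from a point o of least row sum X + Z, where X is the part from the far set B (x >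
1/Y) and Z the part from the near set C. -/
theorem le_sum_sum_of_metric {ι : Type*} [Fintype ι] (d x : ι → ι → ℝ) {G r κ Y P : ℝ}
    (hd0 : ∀ s t, 0 ≤ d s t) (hsymm : ∀ s t, d s t = d t s)
    (htri : ∀ s t u, d s u ≤ d s t + d t u)
    (hx : ∀ s t, x s t * G ≤ d s t)
    (hsmall : ∀ s t, x s t ≤ 1 / Y → r * (x s t * G) ≤ d s t)
    (hmid : ∀ s t, x s t ≤ 1 / 2 → (1 + κ) * (x s t * G) ≤ d s t)
    (hsum : ∀ s, 1 ≤ ∑ t, x s t)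
    (hG : 0 < G) (hr : 2 < r) (hκ : 0 ≤ κ) (hY : 0 < Y) (hP : 6 ≤ P)
    (h1 : 2 / r * Fintype.card ι ≤ Fintype.card ι - 4 * Y)
    (h2 : 6 * Y ≤ Fintype.card ι * κ) :
    2 * (Fintype.card ι - P) * G ≤ ∑ s, ∑ t, d s t := by
  classical
  obtain ⟨n, hn⟩ : ∃ n : ℝ, n = Fintype.card ι := ⟨_, rfl⟩
  rw [← hn] at h1 h2 ⊢
  have hr0 : 0 < r := by linarith
  have hn0 : 0 ≤ n := by rw [hn]; positivity
  have hnY : 4 * Y ≤ n := by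
    have : 0 ≤ 2 / r * n := by positivity
    linarith
  have hne : Nonempty ι := by
    rw [← Fintype.card_pos_iff, ← @Nat.cast_pos ℝ, ← hn]
    linarith
  obtain ⟨o, -, ho⟩ := Finset.exists_min_image Finset.univ (fun s => ∑ t, d s t)
    Finset.univ_nonempty
  set B := Finset.univ.filter (fun t => 1 / Y < x o t) with hB
  set C := Finset.univ.filter (fun t => ¬ 1 / Y < x o t) with hC
  set X := ∑ t ∈ B, d o t with hX
  set Z := ∑ t ∈ C, d o t with hZ
  obtain ⟨b, hb⟩ : ∃ b : ℝ, b = B.card := ⟨_, rfl⟩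
  have split : ∀ f : ι → ℝ, ∑ t, f t = ∑ t ∈ B, f t + ∑ t ∈ C, f t := fun f =>
    (Finset.sum_filter_add_sum_filter_not Finset.univ (fun t => 1 / Y < x o t) f).symm
  have hcC : (C.card : ℝ) = n - b := by
    have := split (fun _ => 1)
    simp only [Finset.sum_const, nsmul_eq_mul, mul_one, Finset.card_univ] at this
    rw [hn, hb]; linarith
  have hR : ∀ s, X + Z ≤ ∑ t, d s t := fun s => by
    rw [← split (d o)]; exact ho s (Finset.mem_univ s)
  have hX0 : 0 ≤ X := Finset.sum_nonneg fun t _ => hd0 o t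
  have hZ0 : 0 ≤ Z := Finset.sum_nonneg fun t _ => hd0 o t
  have hb0 : 0 ≤ b := by rw [hb]; positivity
  by_cases hbig : 2 * G ≤ X + Z
  · calc 2 * (n - P) * G ≤ n * (2 * G) := by nlinarith
      _ ≤ n * (X + Z) := by gcongr
      _ = ∑ s : ι, (X + Z) := by simp [hn, mul_add]
      _ ≤ _ := Finset.sum_le_sum fun s _ => hR s
  push Not at hbig
  -- Each far point costs more than G/Y, and the whole row costs less than 2G.
  have hbY : b ≤ 2 * Y := by
    have h : b * (1 / Y * G) ≤ X := by
      rw [hb, ← nsmul_eq_mul]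
      refine Finset.card_nsmul_le_sum _ _ _ fun t ht => ?_
      refine le_trans ?_ (hx o t)
      have := (Finset.mem_filter.1 ht).2
      gcongr
    have h' : b * (1 / Y * G) ≤ 2 * G := by linarith
    have e : b * (1 / Y * G) = b / Y * G := by ring
    rw [e] at h'
    exact (div_le_iff₀ hY).1 (le_of_mul_le_mul_right h' hG)
  have hS1 : (n - b) * (X + Z) ≤ ∑ s ∈ C, ∑ t, d s t := by
    rw [← hcC, ← nsmul_eq_mul]
    exact Finset.card_nsmul_le_sum _ _ _ fun s _ => hR s
  -- For s far and t near, d(s,t) ≥ d(o,s) - d(o,t). Summed over B × C, this gives X a second time.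
  have hS2 : (n - b) * X - b * Z ≤ ∑ s ∈ B, ∑ t, d s t := by
    have : ∑ s ∈ B, ∑ t ∈ C, (d o s - d o t) = (n - b) * X - b * Z := by
      simp only [Finset.sum_sub_distrib, Finset.sum_const, nsmul_eq_mul, hcC, ← hZ, ← hb]
      rw [← Finset.mul_sum]
    rw [← this]
    refine Finset.sum_le_sum fun s _ => ?_
    rw [split (d s)]
    have h3 : ∑ t ∈ C, (d o s - d o t) ≤ ∑ t ∈ C, d s t := by
      refine Finset.sum_le_sum fun t _ => ?_
      have := htri o t s
      rw [hsymm t s] at this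
      linarith
    have h4 : 0 ≤ ∑ t ∈ B, d s t := Finset.sum_nonneg fun t _ => hd0 s t
    linarith
  have hS : 2 * (n - b) * X + (n - 2 * b) * Z ≤ ∑ s, ∑ t, d s t := by
    rw [split]; linarith
  -- Since r > 2 and b is small against n, the weight n - 2b of Z is at least 2(n - b)/r. It remains
  -- to bound X + Z/r from below, by G or better.
  have hS' : 2 * (n - b) * (X + Z / r) ≤ ∑ s, ∑ t, d s t := by
    refine le_trans ?_ hS
    have h3 : 2 / r * (n - b) ≤ n - 2 * b := by
      have : 0 ≤ 2 / r * b := by positivity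
      linarith
    have h4 := mul_le_mul_of_nonneg_right h3 hZ0
    have e : 2 * (n - b) * (X + Z / r) = 2 * (n - b) * X + 2 / r * (n - b) * Z := by ring
    rw [e]; linarith
  have hZr : (∑ t ∈ C, x o t) * G ≤ Z / r := by
    rw [le_div_iff₀ hr0, Finset.sum_mul, Finset.sum_mul]
    refine Finset.sum_le_sum fun t ht => ?_
    have := hsmall o t (not_lt.1 (Finset.mem_filter.1 ht).2)
    linarith
  have hxsum : G ≤ (∑ t ∈ B, x o t) * G + (∑ t ∈ C, x o t) * G := by
    rw [← add_mul, ← split]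
    exact le_mul_of_one_le_left hG.le (hsum o)
  by_cases hbP : b ≤ P
  · have h3 : (∑ t ∈ B, x o t) * G ≤ X := by
      rw [Finset.sum_mul]
      exact Finset.sum_le_sum fun t _ => hx o t
    have h4 : G ≤ X + Z / r := by linarith
    refine le_trans ?_ hS'
    have : 2 * (n - P) * G ≤ 2 * (n - b) * G := by gcongr
    refine this.trans ?_
    have : 0 ≤ 2 * (n - b) := by linarith
    gcongr
  push Not at hbP
  -- With more than P far points the loss b must be compensated. All but at most 4 of them satisfy x
  -- ≤ 1/2 and gain the factor 1 + κ.
  set E := B.filter (fun t => ¬ x o t ≤ 1 / 2) with hE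
  set D := B.filter (fun t => x o t ≤ 1 / 2) with hD
  have split' : ∀ f : ι → ℝ, ∑ t ∈ B, f t = ∑ t ∈ D, f t + ∑ t ∈ E, f t := fun f =>
    (Finset.sum_filter_add_sum_filter_not B (fun t => x o t ≤ 1 / 2) f).symm
  have hE4 : (E.card : ℝ) ≤ 4 := by
    have h : (E.card : ℝ) * (1 / 2 * G) ≤ ∑ t ∈ E, d o t := by
      rw [← nsmul_eq_mul]
      refine Finset.card_nsmul_le_sum _ _ _ fun t ht => ?_
      refine le_trans ?_ (hx o t)
      have := not_le.1 (Finset.mem_filter.1 ht).2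
      gcongr
    have h3 : ∑ t ∈ E, d o t ≤ X := by
      rw [hX, split']
      linarith [Finset.sum_nonneg fun t (_ : t ∈ D) => hd0 o t]
    have h4 : (E.card : ℝ) * (1 / 2 * G) = (E.card : ℝ) / 2 * G := by ring
    have h5 : (E.card : ℝ) / 2 * G ≤ 2 * G := by linarith
    linarith [le_of_mul_le_mul_right h5 hG]
  -- b - 4 ≥ b/3 because b > P ≥ 6.
  have hDc : b / 3 ≤ D.card := by
    have := split' (fun _ => 1)
    simp only [Finset.sum_const, nsmul_eq_mul, mul_one] at this
    rw [← hb] at this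
    linarith
  have hDx : b / 3 * (1 / Y) ≤ ∑ t ∈ D, x o t := by
    have : (D.card : ℝ) * (1 / Y) ≤ ∑ t ∈ D, x o t := by
      rw [← nsmul_eq_mul]
      refine Finset.card_nsmul_le_sum _ _ _ fun t ht => ?_
      exact (Finset.mem_filter.1 (Finset.mem_filter.1 ht).1).2.le
    refine le_trans ?_ this
    gcongr
  have hXD : (∑ t ∈ B, x o t) * G + κ * (b / 3 * (1 / Y)) * G ≤ X := by
    have h3 : (1 + κ) * (∑ t ∈ D, x o t) * G ≤ ∑ t ∈ D, d o t := by
      rw [mul_assoc, Finset.sum_mul, Finset.mul_sum]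
      exact Finset.sum_le_sum fun t ht => hmid o t (Finset.mem_filter.1 ht).2
    have h4 : (∑ t ∈ E, x o t) * G ≤ ∑ t ∈ E, d o t := by
      rw [Finset.sum_mul]
      exact Finset.sum_le_sum fun t _ => hx o t
    have h5 : κ * (b / 3 * (1 / Y)) * G ≤ κ * (∑ t ∈ D, x o t) * G := by gcongr
    rw [hX, split' (d o), split' (x o)]
    linarith
  refine le_trans ?_ hS'
  have h3 : (1 + κ * (b / 3 * (1 / Y))) * G ≤ X + Z / r := by linarith
  have h4 : 0 ≤ 2 * (n - b) := by linarith
  refine le_trans ?_ (mul_le_mul_of_nonneg_left h3 h4)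
  -- The hypotheses 6Y ≤ nκ and b ≤ 2Y ≤ n/2 make the gain (n - b)κb/(3Y) at least b, so the lower
  -- bound is even n.
  have h5 : n - P ≤ (n - b) * (1 + κ * (b / 3 * (1 / Y))) := by
    have h6 : 3 * Y ≤ (n - b) * κ := by nlinarith
    have h7 : b ≤ (n - b) * (κ * (b / 3 * (1 / Y))) := by
      have : (n - b) * (κ * (b / 3 * (1 / Y))) = ((n - b) * κ) * (b / (3 * Y)) := by
        field_simp
      rw [this]
      calc b = (3 * Y) * (b / (3 * Y)) := by field_simp
        _ ≤ _ := by gcongr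
    linarith
  have h6 := mul_le_mul_of_nonneg_right h5 hG.le
  linarith

/-! ### Choice of parameters and the bound for integer-valued metrics -/

open Filter in
-- With L = log n + 1, the gain for near points tends to kθ > l. The other two conditions hold
-- because n^θ = o(n), 2/e^l < 1, and log n = o(n^(1-θ)).
theorem eventually_loxton_parameters {k θ l C D : ℝ} (hk : 0 < k) (hθ1 : θ < 1) (hl : l < k * θ)
    (hl2 : Real.log 2 < l) (hD : 0 < D) (c : ℝ) :
    ∀ᶠ n : ℝ in atTop, 2 ≤ Real.log n + 1 ∧ c ≤ n ∧ 1 ≤ n ∧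
      l ≤ k * ((θ * Real.log n - C) * (1 / (Real.log n + 1) - 1 / (Real.log n + 1) ^ 2)) ∧
      2 / Real.exp l * n ≤ n - 4 * n ^ θ ∧
      6 * n ^ θ ≤ n * (k * (D * (1 / (Real.log n + 1) - 1 / (Real.log n + 1) ^ 2))) := by
  have hy : ∀ y : ℝ, 1 ≤ y → 1 / (y + 1) - 1 / (y + 1) ^ 2 = y / (y + 1) ^ 2 := by
    intro y hy
    field_simp; ring
  have hylim : Tendsto Real.log atTop atTop := Real.tendsto_log_atTop
  have e1 : ∀ᶠ y : ℝ in atTop, l ≤ k * ((θ * y - C) * (1 / (y + 1) - 1 / (y + 1) ^ 2)) := by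
    have hpos : 0 < k * θ - l := by linarith
    filter_upwards [eventually_ge_atTop 1,
      eventually_ge_atTop ((|2 * l + k * C| + |l|) / (k * θ - l))] with y h1 h2
    rw [hy y h1]
    have h3 : |2 * l + k * C| + |l| ≤ y * (k * θ - l) := (div_le_iff₀ hpos).1 h2
    have e : k * ((θ * y - C) * (y / (y + 1) ^ 2)) = (k * (θ * y - C) * y) / (y + 1) ^ 2 := by
      ring
    rw [e, le_div_iff₀ (by positivity)]
    have h4 := le_abs_self (2 * l + k * C)
    have h5 := le_abs_self l
    have h6 : (|2 * l + k * C| + |l|) * y ≤ y * (k * θ - l) * y := by gcongr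
    have h7 : (2 * l + k * C) * y ≤ |2 * l + k * C| * y := by gcongr
    have h8 : |l| * 1 ≤ |l| * y := by gcongr
    nlinarith
  have hr : 2 / Real.exp l < 1 := by
    rw [div_lt_one (Real.exp_pos _), ← Real.log_lt_iff_lt_exp (by norm_num)]
    exact hl2
  have e2 : ∀ᶠ n : ℝ in atTop, 4 * n ^ θ ≤ (1 - 2 / Real.exp l) * n := by
    have h := tendsto_rpow_neg_atTop (by linarith : 0 < 1 - θ)
    filter_upwards [h.eventually_le_const (by linarith : 0 < (1 - 2 / Real.exp l) / 4),
      eventually_ge_atTop 1] with n h1 h2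
    have h3 : n ^ θ = n * n ^ (-(1 - θ)) := by
      nth_rewrite 2 [← Real.rpow_one n]
      rw [← Real.rpow_add (by linarith)]; congr 1; ring
    rw [h3]
    nlinarith
  have e3 : ∀ᶠ n : ℝ in atTop, Real.log n ≤ k * D / 24 * n ^ (1 - θ) := by
    filter_upwards [(isLittleO_log_rpow_atTop (by linarith : 0 < 1 - θ)).def
      (by positivity : 0 < k * D / 24), eventually_ge_atTop 1] with n h1 h2
    rwa [Real.norm_of_nonneg (Real.log_nonneg h2), Real.norm_of_nonneg (by positivity)] at h1
  filter_upwards [hylim.eventually e1, e2, e3, eventually_ge_atTop c, eventually_ge_atTop 1,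
    hylim.eventually (eventually_ge_atTop 1)] with n h1 h2 h3 h4 h5 h6
  refine ⟨by linarith, h4, h5, h1, by linarith, ?_⟩
  rw [hy _ h6]
  have h7 : n = n ^ θ * n ^ (1 - θ) := by
    rw [← Real.rpow_add (by linarith)]; simp
  set y := Real.log n with hyn
  have h8 : 1 / (4 * y) ≤ y / (y + 1) ^ 2 := by
    rw [div_le_div_iff₀ (by positivity) (by positivity)]
    nlinarith
  have h9 : 6 ≤ n ^ (1 - θ) * (k * (D * (y / (y + 1) ^ 2))) := by
    calc 6 = 24 * y * (1 / (4 * y)) := by field_simp; norm_num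
      _ ≤ 24 * (k * D / 24 * n ^ (1 - θ)) * (y / (y + 1) ^ 2) := by gcongr
      _ = _ := by ring
  calc 6 * n ^ θ = n ^ θ * 6 := by ring
    _ ≤ n ^ θ * (n ^ (1 - θ) * (k * (D * (y / (y + 1) ^ 2)))) := by gcongr
    _ = (n ^ θ * n ^ (1 - θ)) * (k * (D * (y / (y + 1) ^ 2))) := by ring
    _ = _ := by rw [← h7]

set_option maxHeartbeats 1000000 in
-- The metric inequality is applied with n = p² points, Y = n^θ, r = e^l, P = p. The constants
-- satisfy log 2 < l < kθ and θ < 1, which is possible exactly because k > log 2.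
theorem exists_loxtonG_sum_bound {k c₁ : ℝ} (hk : Real.log 2 < k) (hc : IsLoxtonConst k c₁) :
    ∃ c₅ : ℝ, 0 < c₅ ∧ ∀ p : ℕ, c₅ ≤ p → ∀ m : Fin p × Fin p → Fin p × Fin p → ℕ,
      (∀ s t, m s t = m t s) → (∀ s t u, m s u ≤ m s t + m t u) →
      ∀ T : ℕ, (∀ s, T ≤ ∑ t, m s t) → Real.log T ≤ (p : ℝ) * ((p : ℝ) - 1) →
        2 * (p : ℝ) * ((p : ℝ) - 1) * loxtonG k c₁ T ≤ ∑ s, ∑ t, loxtonG k c₁ (m s t) := by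
  have hlog2 : 0 < Real.log 2 := Real.log_pos (by norm_num)
  have hk0 : 0 < k := by linarith
  obtain ⟨l, hl2, hlk⟩ := exists_between hk
  obtain ⟨θ, hθ, hθ1⟩ := exists_between ((div_lt_one hk0).2 hlk)
  rw [div_lt_iff₀' hk0] at hθ
  have hc1 := hc.1
  obtain ⟨D, hDdef⟩ : ∃ D, D = Real.log ((1 + c₁) / (1 / 2 + c₁)) := ⟨_, rfl⟩
  have hD : 0 < D := by
    rw [hDdef]
    exact Real.log_pos ((one_lt_div (by linarith)).2 (by linarith))
  obtain ⟨x₀, hx₀⟩ := Filter.eventually_atTop.1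
    (eventually_loxton_parameters (C := Real.log (1 + c₁)) hk0 hθ1 hθ hl2 hD c₁)
  refine ⟨max x₀ 6, lt_max_of_lt_right (by norm_num), ?_⟩
  intro p hp m hsymm htri T hT hTlog
  have hp6 : (6 : ℝ) ≤ p := (le_max_right _ _).trans hp
  have hdnn : ∀ s t, 0 ≤ loxtonG k c₁ (m s t) := fun s t => loxtonG_nonneg (Nat.cast_nonneg _)
  rcases Nat.eq_zero_or_pos T with rfl | hT0
  · simp only [Nat.cast_zero, loxtonG_zero, mul_zero]
    exact Finset.sum_nonneg fun s _ => Finset.sum_nonneg fun t _ => hdnn s t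
  have hT1 : (1 : ℝ) ≤ T := by exact_mod_cast hT0
  have hTpos : (0 : ℝ) < T := by linarith
  obtain ⟨n, hn⟩ : ∃ n : ℝ, n = (p : ℝ) ^ 2 := ⟨_, rfl⟩
  have hcard : (Fintype.card (Fin p × Fin p) : ℝ) = n := by
    rw [hn]; simp [sq]
  obtain ⟨hL2, hcn, hn1, h3, h4, h5⟩ := hx₀ n (by
    rw [hn]; nlinarith [(le_max_left x₀ 6).trans hp])
  obtain ⟨L, hL⟩ : ∃ L, L = Real.log n + 1 := ⟨_, rfl⟩
  rw [← hL] at hL2 h3 h5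
  have hdL : 0 ≤ 1 / L - 1 / L ^ 2 := by
    rw [sub_nonneg]
    exact one_div_le_one_div_of_le (by linarith) (by nlinarith)
  -- The bound on log T gives T + c₁ ≤ e^(n+1), whence log(T + c₁) ≤ n + 1 ≤ en. This makes L depend
  -- on n alone.
  have hTL : Real.log (Real.log ((T : ℝ) + c₁)) ≤ L := by
    have hTn : (T : ℝ) ≤ Real.exp n := by
      rw [← Real.log_le_iff_le_exp hTpos]
      refine hTlog.trans ?_
      rw [hn]; nlinarith
    have h6 : (T : ℝ) + c₁ ≤ Real.exp (n + 1) := by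
      rw [Real.exp_add]
      nlinarith [Real.add_one_le_exp n, Real.add_one_le_exp (1 : ℝ), Real.exp_pos n]
    have h7 : Real.log ((T : ℝ) + c₁) ≤ n + 1 := (Real.log_le_iff_le_exp (by linarith)).2 h6
    have h8 : Real.log ((T : ℝ) + c₁) ≤ Real.exp 1 * n := by
      nlinarith [Real.add_one_le_exp (1 : ℝ)]
    have h9 : 0 < Real.log ((T : ℝ) + c₁) :=
      (Real.exp_pos 2).trans_le (hc.exp_two_le_log hTpos.le)
    calc Real.log (Real.log ((T : ℝ) + c₁)) ≤ Real.log (Real.exp 1 * n) :=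
          Real.log_le_log h9 h8
      _ = L := by
        rw [Real.log_mul (Real.exp_ne_zero _) (by linarith), Real.log_exp, hL, add_comm]
  set G := loxtonG k c₁ T with hG
  have hG0 : 0 < G := loxtonG_pos hTpos
  have hmono : ∀ s t, loxtonG k c₁ (min (m s t : ℝ) T) ≤ loxtonG k c₁ (m s t) := fun s t =>
    hc.monotoneOn (by simp only [Set.mem_Ici]; positivity) (by simp) (min_le_left _ _)
  have hgain : ∀ (s t : Fin p × Fin p) (A : ℝ),
      A ≤ Real.exp (k * ((Real.log ((T : ℝ) + c₁) - Real.log (min (m s t : ℝ) T + c₁)) *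
        (1 / L - 1 / L ^ 2))) →
      A * (min (m s t : ℝ) T / T * G) ≤ loxtonG k c₁ (m s t) := by
    intro s t A hA
    have h6 := hc.mul_exp_le hk0.le (m := min (m s t : ℝ) T) (by positivity)
      (min_le_right _ _) hTL
    refine le_trans ?_ (hmono s t)
    have e : A * (min (m s t : ℝ) T / T * G) = (min (m s t : ℝ) T * G * A) / T := by ring
    rw [e, div_le_iff₀ hTpos, mul_comm (loxtonG _ _ _)]
    refine le_trans ?_ h6
    gcongr
  have main := le_sum_sum_of_metric (fun s t => loxtonG k c₁ (m s t))
    (fun s t => min (m s t : ℝ) T / T) (G := G) (r := Real.exp l)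
    (κ := k * (D * (1 / L - 1 / L ^ 2))) (Y := n ^ θ) (P := p) hdnn
    (fun s t => by simp only [hsymm s t]) ?_ ?_ ?_ ?_ ?_ hG0 ?_
    (by positivity) (by positivity) hp6 (by rwa [hcard]) (by rwa [hcard])
  · rw [hcard, hn] at main
    refine le_trans (le_of_eq ?_) main
    ring
  · intro s t u
    refine le_trans ?_ (hc.add_le hk0.le (Nat.cast_nonneg _) (Nat.cast_nonneg _))
    refine hc.monotoneOn (by simp) (by simp only [Set.mem_Ici]; positivity) ?_
    exact_mod_cast htri s t u
  · intro s t
    have := hgain s t 1 (Real.one_le_exp (mul_nonneg hk0.le (mul_nonneg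
      (sub_nonneg.2 (Real.log_le_log (by positivity) (by gcongr; exact min_le_right _ _))) hdL)))
    rwa [one_mul] at this
  · intro s t hst
    rcases Nat.eq_zero_or_pos (m s t) with h0 | h0
    · simp only [h0, Nat.cast_zero, loxtonG_zero]
      rw [min_eq_left hTpos.le]; simp
    refine hgain s t _ (Real.exp_le_exp.2 (h3.trans ?_))
    -- Lengths are integers, so m ≥ 1 here. Then (T + c₁)/(q + c₁) ≥ n^θ/(1 + c₁) for q = min(m, T),
    -- which is the source of C = log(1 + c₁).
    have hY : 0 < n ^ θ := by positivity
    have hq1 : (1 : ℝ) ≤ min (m s t : ℝ) T := le_min (by exact_mod_cast h0) hT1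
    have hqY : min (m s t : ℝ) T * n ^ θ ≤ T := by
      rwa [div_le_div_iff₀ hTpos hY, one_mul] at hst
    refine mul_le_mul_of_nonneg_left (mul_le_mul_of_nonneg_right ?_ hdL) hk0.le
    rw [← Real.log_rpow (by linarith), ← Real.log_div (by positivity) (by positivity),
      ← Real.log_div (by positivity) (by positivity)]
    refine Real.log_le_log (by positivity) ?_
    rw [div_le_div_iff₀ (by positivity) (by positivity)]
    have hTY : n ^ θ ≤ T := le_trans (le_mul_of_one_le_left hY.le hq1) hqY
    nlinarith
  · intro s t hst
    -- For q ≤ T/2 and T ≥ 1 the ratio (T + c₁)/(q + c₁) is at least (1 + c₁)/(1/2 + c₁), whose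
    -- logarithm is D.
    have hq : min (m s t : ℝ) T ≤ T / 2 := by
      rw [div_le_div_iff₀ hTpos (by norm_num)] at hst; linarith
    refine hgain s t _ ?_
    rw [add_comm]
    refine (Real.add_one_le_exp _).trans (Real.exp_le_exp.2 ?_)
    refine mul_le_mul_of_nonneg_left (mul_le_mul_of_nonneg_right ?_ hdL) hk0.le
    rw [hDdef, ← Real.log_div (by positivity) (by positivity)]
    refine Real.log_le_log (by positivity) ?_
    rw [div_le_div_iff₀ (by positivity) (by positivity)]
    nlinarith
  · intro s
    rw [← Finset.sum_div, le_div_iff₀ hTpos, one_mul]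
    by_cases h : ∃ t, T ≤ m s t
    · obtain ⟨t, ht⟩ := h
      have h6 : (T : ℝ) ≤ min (m s t : ℝ) T := le_min (by exact_mod_cast ht) le_rfl
      refine h6.trans (Finset.single_le_sum (f := fun t => min (m s t : ℝ) T)
        (fun t _ => by positivity) (Finset.mem_univ t))
    · push Not at h
      have : ∀ t, min (m s t : ℝ) T = m s t := fun t =>
        min_eq_left (by exact_mod_cast (h t).le)
      simp only [this]
      exact_mod_cast hT s
  · rw [← Real.log_lt_iff_lt_exp (by norm_num)]
    exact hl2

/-! ### The discriminant of a first step as an integer determinant -/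

/-- The coefficient of `z ^ s.1 * w ^ s.2` in `z ^ i * w ^ j`, when `z` is a primitive `q`-th root
of unity and `w ^ q = a`. -/
def kummerCoeff (a q i j : ℕ) (s : Fin (q - 1) × Fin q) : ℤ :=
  (if i % q = q - 1 then -1 else if i % q = s.1 then 1 else 0) *
    (if j % q = s.2 then (a : ℤ) ^ (j / q) else 0)

/-- The trace form matrix of the family `z ^ l * w ^ n`, `l < q - 1`, `n < q`. -/
def kummerTraceMatrix (a q : ℕ) : Matrix (Fin (q - 1) × Fin q) (Fin (q - 1) × Fin q) ℤ :=
  Matrix.of fun s t => ∑ u : Fin (q - 1) × Fin q,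
    kummerCoeff a q (s.1 + t.1 + u.1) (s.2 + t.2 + u.2) u

/-- Exponents are reduced modulo q, and z^(q-1) is replaced by minus the sum of the lower powers. -/
theorem pow_mul_pow_eq_sum_kummerCoeff {R : Type*} [CommRing R] {a q : ℕ} (hq : 0 < q) {z w : R}
    (hz : z ^ q = 1) (hz' : ∑ i ∈ Finset.range q, z ^ i = 0) (hw : w ^ q = a) (i j : ℕ) :
    z ^ i * w ^ j = ∑ s : Fin (q - 1) × Fin q,
      (kummerCoeff a q i j s : R) * (z ^ (s.1 : ℕ) * w ^ (s.2 : ℕ)) := by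
  have h1 : z ^ i = ∑ l : Fin (q - 1),
      ((if i % q = q - 1 then -1 else if i % q = l then 1 else 0 : ℤ) : R) * z ^ (l : ℕ) := by
    have e : z ^ i = z ^ (i % q) := by
      conv_lhs => rw [← Nat.div_add_mod i q, pow_add, pow_mul, hz, one_pow, one_mul]
    rw [e]
    split_ifs with h
    · obtain ⟨r, rfl⟩ : ∃ r, q = r + 1 := ⟨q - 1, by omega⟩
      rw [h]
      rw [Finset.sum_range_succ] at hz'
      simp only [Nat.add_sub_cancel, Int.cast_neg, Int.cast_one, neg_mul, one_mul,
        Finset.sum_neg_distrib]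
      rw [Fin.sum_univ_eq_sum_range (fun x => z ^ x)]
      simp only [Nat.add_sub_cancel]
      linear_combination hz'
    · have hlt : i % q < q - 1 := by
        have := Nat.mod_lt i hq
        omega
      rw [Finset.sum_eq_single (⟨i % q, hlt⟩ : Fin (q - 1))]
      · simp
      · intro b _ hb
        have : i % q ≠ b := fun h' => hb (Fin.ext h'.symm)
        simp [this]
      · simp
  have h2 : w ^ j = ∑ n : Fin q,
      ((if j % q = n then (a : ℤ) ^ (j / q) else 0 : ℤ) : R) * w ^ (n : ℕ) := by
    rw [Finset.sum_eq_single (⟨j % q, Nat.mod_lt j hq⟩ : Fin q)]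
    · simp only [if_true, Int.cast_pow, Int.cast_natCast]
      rw [← hw, ← pow_mul, ← pow_add, Nat.div_add_mod]
    · intro b _ hb
      have : j % q ≠ b := fun h' => hb (Fin.ext h'.symm)
      simp [this]
    · simp
  rw [h1, h2, Finset.sum_mul_sum, Fintype.sum_prod_type]
  refine Finset.sum_congr rfl fun l _ => Finset.sum_congr rfl fun n _ => ?_
  unfold kummerCoeff
  push_cast
  ring

/-- A nonzero discriminant makes the spanning family a basis. Its structure constants are integers
depending only on a and q, hence so are the traces. -/
theorem discr_eq_det_kummerTraceMatrix {K L : Type*} [Field K] [Field L] [Algebra K L]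
    {a q : ℕ} (hq : 1 < q) {z w : L} (hz : IsPrimitiveRoot z q) (hw : w ^ q = a)
    {b : Fin (q - 1) × Fin q → L} (hb : ∀ s, b s = z ^ (s.1 : ℕ) * w ^ (s.2 : ℕ))
    (hspan : ⊤ ≤ Submodule.span K (Set.range b)) (hne : Algebra.discr K b ≠ 0) :
    Algebra.discr K b = ((kummerTraceMatrix a q).det : K) := by
  classical
  have hli : LinearIndependent K b := by
    by_contra h
    exact hne (Algebra.discr_zero_of_not_linearIndependent K h)
  let B := Module.Basis.mk hli hspan
  have hB : ∀ s, B s = z ^ (s.1 : ℕ) * w ^ (s.2 : ℕ) := fun s => by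
    rw [← hb]; simp [B]
  have hrepr : ∀ i j s, B.repr (z ^ i * w ^ j) s = (kummerCoeff a q i j s : K) := by
    intro i j s
    have h : z ^ i * w ^ j = ∑ s, (kummerCoeff a q i j s : K) • B s := by
      rw [pow_mul_pow_eq_sum_kummerCoeff (a := a) (by omega) hz.pow_eq_one
        (hz.geom_sum_eq_zero hq) hw]
      refine Finset.sum_congr rfl fun s _ => ?_
      rw [hB, Algebra.smul_def, map_intCast]
    rw [h, B.repr_sum_self]
  have htrace : ∀ i j, Algebra.trace K L (z ^ i * w ^ j) =
      ((∑ u : Fin (q - 1) × Fin q, kummerCoeff a q (i + u.1) (j + u.2) u : ℤ) : K) := by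
    intro i j
    rw [Algebra.trace_eq_matrix_trace B, Matrix.trace]
    push_cast
    refine Finset.sum_congr rfl fun u _ => ?_
    rw [Matrix.diag_apply, Algebra.leftMulMatrix_eq_repr_mul, hB, ← hrepr]
    congr 2
    ring
  rw [Algebra.discr_def, ← eq_intCast (Int.castRingHom K), RingHom.map_det]
  congr 1
  ext s t
  rw [Algebra.traceMatrix_apply, Algebra.traceForm_apply, hb, hb]
  have e : z ^ (s.1 : ℕ) * w ^ (s.2 : ℕ) * (z ^ (t.1 : ℕ) * w ^ (t.2 : ℕ)) =
      z ^ ((s.1 : ℕ) + t.1) * w ^ ((s.2 : ℕ) + t.2) := by ring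
  rw [e, htrace]
  rfl

/-- The trace factors into a z-part and a w-part. The w-part vanishes unless s.2 + t.2 = qc, and is
then q·a^c, with c ≥ 1 when s.2 ≠ 0. -/
theorem dvd_kummerTraceMatrix (a q : ℕ) (s t : Fin (q - 1) × Fin q) :
    (q : ℤ) * (if (s.2 : ℕ) = 0 then 1 else (a : ℤ)) ∣ kummerTraceMatrix a q s t := by
  have hq : 0 < q := s.2.pos
  unfold kummerTraceMatrix kummerCoeff
  have e : ∀ f g : ℕ → ℤ, ∑ u : Fin (q - 1) × Fin q, f u.1 * g u.2 =
      (∑ l : Fin (q - 1), f l) * ∑ n : Fin q, g n := by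
    intro f g
    rw [Fintype.sum_prod_type, Finset.sum_mul_sum]
  rw [Matrix.of_apply, e (fun l => if ((s.1 : ℕ) + t.1 + l) % q = q - 1 then -1 else
    if ((s.1 : ℕ) + t.1 + l) % q = l then 1 else 0) (fun n => if ((s.2 : ℕ) + t.2 + n) % q = n then
    (a : ℤ) ^ (((s.2 : ℕ) + t.2 + n) / q) else 0)]
  refine Dvd.dvd.mul_left ?_ _
  by_cases hj : q ∣ (s.2 : ℕ) + t.2
  · obtain ⟨c, hc⟩ := hj
    have : ∀ n : Fin q, (if ((s.2 : ℕ) + t.2 + n) % q = n then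
        (a : ℤ) ^ (((s.2 : ℕ) + t.2 + n) / q) else 0) = (a : ℤ) ^ c := by
      intro n
      rw [hc, Nat.mul_add_mod, Nat.mod_eq_of_lt n.2, if_pos rfl, Nat.mul_add_div hq,
        Nat.div_eq_of_lt n.2, add_zero]
    simp only [this, Finset.sum_const, Finset.card_univ, Fintype.card_fin, nsmul_eq_mul]
    refine mul_dvd_mul_left _ ?_
    split_ifs with h0
    · exact one_dvd _
    · refine dvd_pow_self _ ?_
      rintro rfl
      omega
  · have : ∀ n : Fin q, (if ((s.2 : ℕ) + t.2 + n) % q = n then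
        (a : ℤ) ^ (((s.2 : ℕ) + t.2 + n) / q) else 0) = 0 := by
      intro n
      rw [if_neg]
      intro h
      apply hj
      have h' : (s.2 : ℕ) + t.2 + n ≡ 0 + n [MOD q] := by
        rw [Nat.ModEq, h, zero_add, Nat.mod_eq_of_lt n.2]
      exact (Nat.modEq_zero_iff_dvd).1 (Nat.ModEq.add_right_cancel' _ h')
    simp only [this, Finset.sum_const_zero, dvd_zero]

theorem Matrix.prod_dvd_det {ι : Type*} [Fintype ι] [DecidableEq ι] {R : Type*} [CommRing R]
    (A : Matrix ι ι R) (v : ι → R) (h : ∀ i j, v i ∣ A i j) : ∏ i, v i ∣ A.det := by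
  choose B hB using h
  have : A = Matrix.of fun i j => v i * B i j := by
    ext i j; exact hB i j
  rw [this, show (Matrix.of fun i j => v i * B i j).det = _ from
    Matrix.det_mul_column v (Matrix.of B)]
  exact dvd_mul_right _ _

/-- The rows with exponents (0,0) and (0,1) alone contribute the divisor q·qa ≥ 4a. -/
theorem four_mul_le_abs_det_kummerTraceMatrix {a q : ℕ} (ha : 0 < a) (hq : 1 < q)
    (h : (kummerTraceMatrix a q).det ≠ 0) : 4 * (a : ℤ) ≤ |(kummerTraceMatrix a q).det| := by
  have hdvd := Matrix.prod_dvd_det _ _ (dvd_kummerTraceMatrix a q)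
  rw [← dvd_abs] at hdvd
  refine le_trans ?_ (Int.le_of_dvd (abs_pos.2 h) hdvd)
  let s₀ : Fin (q - 1) × Fin q := (⟨0, by omega⟩, ⟨0, by omega⟩)
  let s₁ : Fin (q - 1) × Fin q := (⟨0, by omega⟩, ⟨1, by omega⟩)
  have hne : s₀ ≠ s₁ := by simp [s₀, s₁]
  have ha' : (1 : ℤ) ≤ a := by exact_mod_cast ha
  have hq' : (2 : ℤ) ≤ q := by exact_mod_cast hq
  have h1 : ∀ s : Fin (q - 1) × Fin q,
      (1 : ℤ) ≤ q * (if (s.2 : ℕ) = 0 then 1 else (a : ℤ)) := by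
    intro s
    split_ifs <;> nlinarith
  have h2 := Finset.prod_le_prod_of_subset_of_one_le (Finset.subset_univ {s₀, s₁})
    (f := fun s : Fin (q - 1) × Fin q => (q : ℤ) * (if (s.2 : ℕ) = 0 then 1 else (a : ℤ)))
    (fun s _ => zero_le_one.trans (h1 s)) (fun s _ _ => h1 s)
  refine le_trans ?_ h2
  rw [Finset.prod_pair hne]
  simp only [s₀, s₁, if_true, one_ne_zero, if_false, mul_one]
  nlinarith [mul_le_mul hq' hq' (by norm_num) (by linarith)]

/-! ### Spanning sets and integrality for one step of the tower -/

theorem finiteDimensional_kummerField (a : ℕ) {N : ℕ} (hN : N ≠ 0) :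
    FiniteDimensional ℚ (kummerField a N) := by
  have hfin : Set.Finite {z : ℂ | z ^ N = (a : ℂ)} := by
    have h := (Polynomial.nthRootsFinset N (a : ℂ)).finite_toSet
    refine h.subset fun z hz => ?_
    simpa [Polynomial.mem_nthRootsFinset (Nat.pos_of_ne_zero hN)] using hz
  have := hfin.to_subtype
  refine IntermediateField.finiteDimensional_adjoin fun x hx => ?_
  have hx' : x ^ N = (a : ℂ) := hx
  refine IsIntegral.of_pow (Nat.pos_of_ne_zero hN) ?_
  rw [hx']
  exact isIntegral_natCast a

section Step

variable {a m M q : ℕ}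

/-- For a root x of X^(qm) - a, x^q lies in ℚ_a(m), and x^m, being a q-th root of a, is w times a
power of z. As q and m are coprime, Bézout recovers x from x^q and x^m. -/
theorem kummerField_le_adjoin_pair (ha : a ≠ 0) (hm : m ≠ 0) (hq : q.Prime) (hqm : ¬ q ∣ m)
    {z w : ℂ} (hz : IsPrimitiveRoot z q) (hw : w ^ q = (a : ℂ)) :
    kummerField a (q * m) ≤
      (IntermediateField.adjoin (kummerField a m) {z, w}).restrictScalars ℚ := by
  refine IntermediateField.adjoin_le_iff.2 fun x hx => ?_
  have hx' : x ^ (q * m) = (a : ℂ) := hx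
  have ha' : (a : ℂ) ≠ 0 := by exact_mod_cast ha
  have hx0 : x ≠ 0 := by
    rintro rfl
    rw [zero_pow (mul_ne_zero hq.ne_zero hm)] at hx'
    exact ha' hx'.symm
  have hw0 : w ≠ 0 := by
    rintro rfl
    rw [zero_pow hq.ne_zero] at hw
    exact ha' hw.symm
  set E := IntermediateField.adjoin (kummerField a m) {z, w} with hE
  have hzE : z ∈ E := IntermediateField.subset_adjoin _ _ (by simp)
  have hwE : w ∈ E := IntermediateField.subset_adjoin _ _ (by simp)
  have h1 : x ^ q ∈ E := by
    have : x ^ q ∈ kummerField a m :=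
      mem_kummerField_of_pow_eq hm dvd_rfl (by rw [← pow_mul, hx'])
    exact E.algebraMap_mem ⟨x ^ q, this⟩
  have h2 : x ^ m ∈ E := by
    have h3 : (x ^ m / w) ^ q = 1 := by
      rw [div_pow, ← pow_mul, mul_comm m q, hx', hw, div_self ha']
    have : NeZero q := ⟨hq.ne_zero⟩
    obtain ⟨i, -, hi⟩ := hz.eq_pow_of_pow_eq_one h3
    have h4 : x ^ m = z ^ i * w := by rw [hi]; field_simp
    rw [h4]
    exact mul_mem (pow_mem hzE i) hwE
  show x ∈ E
  have hg : (1 : ℤ) = q * Nat.gcdA q m + m * Nat.gcdB q m := by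
    rw [← Nat.gcd_eq_gcd_ab, (Nat.Prime.coprime_iff_not_dvd hq).2 hqm]; rfl
  have hx1 : x = (x ^ q) ^ (Nat.gcdA q m) * (x ^ m) ^ (Nat.gcdB q m) := by
    rw [← zpow_natCast, ← zpow_natCast, ← zpow_mul, ← zpow_mul, ← zpow_add₀ hx0, ← hg, zpow_one]
  rw [hx1]
  exact mul_mem (zpow_mem h1 _) (zpow_mem h2 _)

theorem top_le_span_kummer (ha : a ≠ 0) (hm : m ≠ 0) (hq : q.Prime) (hqm : ¬ q ∣ m)
    (hM : M = q * m) (h : kummerField a m ≤ kummerField a M)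
    {z w : IntermediateField.extendScalars h} (hz : IsPrimitiveRoot z q) (hw : w ^ q = a)
    {b : Fin (q - 1) × Fin q → IntermediateField.extendScalars h}
    (hb : ∀ s, b s = z ^ (s.1 : ℕ) * w ^ (s.2 : ℕ)) :
    ⊤ ≤ Submodule.span (kummerField a m) (Set.range b) := by
  subst hM
  set S := Submodule.span (kummerField a m) (Set.range b) with hS
  have hzC : IsPrimitiveRoot (z : ℂ) q := hz.map_of_injective
    (f := (IntermediateField.extendScalars h).val) Subtype.val_injective
  have hwC : (w : ℂ) ^ q = a := by exact_mod_cast congrArg Subtype.val hw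
  have hmono : ∀ i j, z ^ i * w ^ j ∈ S := by
    intro i j
    rw [pow_mul_pow_eq_sum_kummerCoeff (a := a) hq.pos hz.pow_eq_one
      (hz.geom_sum_eq_zero hq.one_lt) hw]
    refine Submodule.sum_mem _ fun s _ => ?_
    rw [← hb, ← zsmul_eq_mul]
    exact zsmul_mem (Submodule.subset_span (Set.mem_range_self s)) _
  have hadj : (Algebra.adjoin (kummerField a m) {(z : ℂ), (w : ℂ)}).toSubmodule ≤
      S.map (IntermediateField.extendScalars h).val.toLinearMap := by
    rw [Algebra.adjoin_eq_span, Submodule.span_le]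
    intro x hx
    obtain ⟨i, j, rfl⟩ := (Submonoid.mem_closure_pair _ _ _).1 hx
    exact ⟨z ^ i * w ^ j, hmono i j, by simp⟩
  intro y _
  have hy := kummerField_le_adjoin_pair ha hm hq hqm hzC hwC y.2
  have halg : ∀ x : ℂ, x ^ q = 1 ∨ x ^ q = a → IsAlgebraic (kummerField a m) x := by
    intro x hx
    refine IsIntegral.isAlgebraic (IsIntegral.of_pow hq.pos ?_)
    rcases hx with hx | hx <;> rw [hx]
    · exact isIntegral_one
    · exact isIntegral_natCast a
  have hy' : (y : ℂ) ∈ Algebra.adjoin (kummerField a m) {(z : ℂ), (w : ℂ)} := by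
    rw [← IntermediateField.adjoin_toSubalgebra_of_isAlgebraic]
    · exact hy
    · intro x hx
      rcases hx with rfl | rfl
      · exact halg _ (Or.inl hzC.pow_eq_one)
      · exact halg _ (Or.inr hwC)
  obtain ⟨y', hy'S, hy'y⟩ := hadj hy'
  have : y' = y := Subtype.ext hy'y
  rwa [← this]

/-- The value does not depend on m. Thus the discriminant in r and the one of the p-step in Δ agree
although their base fields may differ. -/
theorem relDisc_eq_intCast (ha : a ≠ 0) (hm : m ≠ 0) (hq : q.Prime) (hqm : ¬ q ∣ m)
    (hM : M = q * m) (h : kummerField a m ≤ kummerField a M) {z w : kummerField a M}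
    (hz : IsPrimitiveRoot (z : ℂ) q) (hw : (w : ℂ) ^ q = a)
    (hne : relDisc (kummerField a m) (kummerField a M) h (q - 1) q z w ≠ 0) :
    relDisc (kummerField a m) (kummerField a M) h (q - 1) q z w =
      ((kummerTraceMatrix a q).det : kummerField a m) := by
  let z' : IntermediateField.extendScalars h := ⟨z, z.2⟩
  let w' : IntermediateField.extendScalars h := ⟨w, w.2⟩
  have hz' : IsPrimitiveRoot z' q := IsPrimitiveRoot.of_map_of_injective
    (f := (IntermediateField.extendScalars h).val) hz Subtype.val_injective
  have hw' : w' ^ q = a := Subtype.ext (by simpa using hw)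
  unfold relDisc at hne ⊢
  refine discr_eq_det_kummerTraceMatrix hq.one_lt hz' hw' (fun s => ?_) ?_ hne
  · exact Subtype.ext (by simp [z', w'])
  · exact top_le_span_kummer ha hm hq hqm hM h hz' hw' fun s =>
      Subtype.ext (by simp [z', w'])

theorem card_le_finrank_of_relDisc_ne_zero {K L : IntermediateField ℚ ℂ}
    [FiniteDimensional ℚ L] (h : K ≤ L) {r q : ℕ} {z w : L} (hne : relDisc K L h r q z w ≠ 0) :
    r * q ≤ Module.finrank ℚ L := by
  unfold relDisc at hne
  have hli : LinearIndependent K (fun x : Fin r × Fin q =>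
    (⟨((z ^ (x.1 : ℕ) * w ^ (x.2 : ℕ) : L) : ℂ), (z ^ (x.1 : ℕ) * w ^ (x.2 : ℕ)).2⟩ :
      IntermediateField.extendScalars h)) := by
    by_contra hc
    exact hne (Algebra.discr_zero_of_not_linearIndependent K hc)
  have hli2 := hli.map' (IntermediateField.extendScalars h).val.toLinearMap
    (LinearMap.ker_eq_bot.2 Subtype.val_injective)
  have hli3 : LinearIndependent ℚ (fun x : Fin r × Fin q =>
      ((z ^ (x.1 : ℕ) * w ^ (x.2 : ℕ) : L) : ℂ)) :=
    hli2.restrict_scalars (R := ℚ) (by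
      intro x y hxy
      simpa [Algebra.smul_def] using hxy)
  have hli4 : LinearIndependent ℚ (fun x : Fin r × Fin q => z ^ (x.1 : ℕ) * w ^ (x.2 : ℕ)) :=
    LinearIndependent.of_comp L.val.toLinearMap hli3
  simpa using hli4.fintype_card_le_finrank

theorem isIntegral_relDisc {K L : IntermediateField ℚ ℂ} [FiniteDimensional ℚ L] (h : K ≤ L)
    {r q : ℕ} {z w : L} (hz : IsIntegral ℤ z) (hw : IsIntegral ℤ w) :
    IsIntegral ℤ (relDisc K L h r q z w) := by
  have : FiniteDimensional ℚ (IntermediateField.extendScalars h) := ‹FiniteDimensional ℚ L›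
  have : FiniteDimensional K (IntermediateField.extendScalars h) :=
    FiniteDimensional.right ℚ K (IntermediateField.extendScalars h)
  unfold relDisc
  refine Algebra.discr_isIntegral K fun s => ?_
  have : IsIntegral ℤ ((z ^ (s.1 : ℕ) * w ^ (s.2 : ℕ) : L) : ℂ) :=
    IsIntegral.map (IsScalarTower.toAlgHom ℤ L ℂ) ((hz.pow _).mul (hw.pow _))
  exact (isIntegral_algHom_iff (IsScalarTower.toAlgHom ℤ (IntermediateField.extendScalars h) ℂ)
    Subtype.val_injective).1 this

end Step

/-! ### Sums of root terms and the length -/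

/-- `x` is a sum of `n` numbers of the form root of unity times `a ^ (j / N)`. -/
def IsRootSum (a N n : ℕ) (x : ℂ) : Prop :=
  ∃ z : Fin n → ℂ, (∀ i, IsRootTerm a N (z i)) ∧ ∑ i, z i = x

namespace IsRootSum

variable {a N n n' : ℕ} {x y : ℂ}

theorem of_fintype {ι : Type*} [Fintype ι] (z : ι → ℂ) (hz : ∀ i, IsRootTerm a N (z i)) :
    IsRootSum a N (Fintype.card ι) (∑ i, z i) :=
  ⟨fun i => z ((Fintype.equivFin ι).symm i), fun _ => hz _,
    Equiv.sum_comp (Fintype.equivFin ι).symm z⟩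

theorem zero : IsRootSum a N 0 0 := ⟨Fin.elim0, fun i => i.elim0, by simp⟩

theorem of_isRootTerm (h : IsRootTerm a N x) : IsRootSum a N 1 x :=
  ⟨fun _ => x, fun _ => h, by simp⟩

theorem sum {ι : Type*} [Fintype ι] {n : ι → ℕ} {x : ι → ℂ}
    (h : ∀ i, IsRootSum a N (n i) (x i)) : IsRootSum a N (∑ i, n i) (∑ i, x i) := by
  choose z hz hsum using h
  have h1 := of_fintype (a := a) (N := N) (fun s : Σ i, Fin (n i) => z s.1 s.2)
    (fun s => hz s.1 s.2)
  rw [Fintype.sum_sigma] at h1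
  simpa [hsum] using h1

theorem add (hx : IsRootSum a N n x) (hy : IsRootSum a N n' y) :
    IsRootSum a N (n + n') (x + y) := by
  have := sum (a := a) (N := N) (n := ![n, n']) (x := ![x, y])
    (by intro i; fin_cases i <;> simpa)
  simpa using this

theorem mul {N' : ℕ} {w : ℂ} (hx : IsRootSum a N n x)
    (h : ∀ z, IsRootTerm a N z → IsRootTerm a N' (z * w)) : IsRootSum a N' n (x * w) := by
  obtain ⟨z, hz, rfl⟩ := hx
  exact ⟨fun i => z i * w, fun i => h _ (hz i), by rw [Finset.sum_mul]⟩

end IsRootSum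

theorem IsRootTerm.neg {a N : ℕ} {z : ℂ} (h : IsRootTerm a N z) : IsRootTerm a N (-z) := by
  obtain ⟨ξ, m, j, hm, hξ, hj, rfl⟩ := h
  refine ⟨-ξ, 2 * m, j, by omega, ?_, hj, by ring⟩
  rw [pow_mul, neg_sq, ← pow_mul, mul_comm, pow_mul, hξ, one_pow]

theorem IsRootSum.neg {a N n : ℕ} {x : ℂ} (hx : IsRootSum a N n x) : IsRootSum a N n (-x) := by
  have := hx.mul (N' := N) (w := -1) (fun z hz => by simpa using hz.neg)
  simpa using this

section Length

variable {a N : ℕ} [NeZero a] {β : ℂ}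

theorem kummerLength_le {n : ℕ} (h : IsRootSum a N n ((kummerDelta a N : ℚ) * β)) :
    kummerLength a N β ≤ n := Nat.sInf_le h

theorem isRootSum_kummerLength {n : ℕ} (h : IsRootSum a N n ((kummerDelta a N : ℚ) * β)) :
    IsRootSum a N (kummerLength a N β) ((kummerDelta a N : ℚ) * β) :=
  Nat.sInf_mem (s := {n | IsRootSum a N n ((kummerDelta a N : ℚ) * β)}) ⟨n, h⟩

/-- The infimum of the empty set is 0, so a nonzero length certifies that a representation exists.
-/
theorem isRootSum_of_kummerLength_ne_zero (h : kummerLength a N β ≠ 0) :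
    IsRootSum a N (kummerLength a N β) ((kummerDelta a N : ℚ) * β) :=
  Nat.sInf_mem (s := {n | IsRootSum a N n ((kummerDelta a N : ℚ) * β)})
    (Nat.nonempty_of_pos_sInf (Nat.pos_of_ne_zero h))

theorem kummerLength_eq_zero_of_mul_eq_zero (h : ((kummerDelta a N : ℚ) : ℂ) * β = 0) :
    kummerLength a N β = 0 :=
  Nat.le_zero.1 (kummerLength_le (by rw [h]; exact IsRootSum.zero))

end Length

/-- Since ∑ w = 0, subtracting x s from every coefficient leaves ∑ x t * w t unchanged.
Representations of the differences, multiplied by the w t, combine into one of the whole sum. -/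
theorem kummerLength_le_sum {a N N' : ℕ} [NeZero a] {ι : Type*} [Fintype ι]
    (hΔ : kummerDelta a N = 1) {x w : ι → ℂ} (hx : ∀ s, ∃ n, IsRootSum a N n (x s))
    (hw : ∀ s z, IsRootTerm a N z → IsRootTerm a N' (z * w s)) (hw0 : ∑ s, w s = 0) {β : ℂ}
    (hβ : ((kummerDelta a N' : ℚ) : ℂ) * β = ∑ s, x s * w s) :
    (∀ s t, kummerLength a N (x s - x t) = kummerLength a N (x t - x s)) ∧
    (∀ s t u, kummerLength a N (x s - x u) ≤
      kummerLength a N (x s - x t) + kummerLength a N (x t - x u)) ∧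
    ∀ s, kummerLength a N' β ≤ ∑ t, kummerLength a N (x s - x t) := by
  have hrep : ∀ s t, IsRootSum a N (kummerLength a N (x s - x t)) (x s - x t) := by
    intro s t
    obtain ⟨n, hn⟩ := hx s
    obtain ⟨n', hn'⟩ := hx t
    have := isRootSum_kummerLength (a := a) (N := N) (n := n + n') (β := x s - x t)
      (by simpa [hΔ, sub_eq_add_neg] using hn.add hn'.neg)
    simpa [hΔ] using this
  have hle : ∀ {n y}, IsRootSum a N n y → kummerLength a N y ≤ n := fun h =>
    kummerLength_le (by simpa [hΔ] using h)
  have hsymm : ∀ s t, kummerLength a N (x s - x t) ≤ kummerLength a N (x t - x s) := fun s t =>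
    hle (by simpa using (hrep t s).neg)
  refine ⟨fun s t => le_antisymm (hsymm s t) (hsymm t s), fun s t u => hle ?_, fun s => ?_⟩
  · simpa using (hrep s t).add (hrep t u)
  · refine kummerLength_le ?_
    have e : ((kummerDelta a N' : ℚ) : ℂ) * β = ∑ t, -(x s - x t) * w t := by
      have : ∑ t, -(x s - x t) * w t = ∑ t, x t * w t - x s * ∑ t, w t := by
        rw [Finset.mul_sum, ← Finset.sum_sub_distrib]
        exact Finset.sum_congr rfl fun t _ => by ring
      rw [this, hw0, hβ]; ring
    rw [e]
    exact IsRootSum.sum fun t => (hrep s t).neg.mul (hw t)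

/-! ### Conjugates of root terms, and integers as sums of roots of unity -/

theorem realRoot_pow (a : ℕ) {N : ℕ} (hN : N ≠ 0) (j : ℕ) :
    realRoot a N j ^ N = (a : ℂ) ^ j := by
  unfold realRoot
  rw [← Complex.ofReal_pow, ← Real.rpow_natCast, ← Real.rpow_mul (Nat.cast_nonneg a),
    div_mul_cancel₀ _ (by exact_mod_cast hN), Real.rpow_natCast]
  push_cast; rfl

theorem realRoot_zero (a N : ℕ) : realRoot a N 0 = 1 := by simp [realRoot]

theorem realRoot_one_left (N j : ℕ) : realRoot 1 N j = 1 := by simp [realRoot]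

theorem isRootTerm_of_pow_eq_one {a N m : ℕ} (hN : 0 < N) (hm : 0 < m) {z : ℂ}
    (hz : z ^ m = 1) : IsRootTerm a N z :=
  ⟨z, m, 0, hm, hz, hN, by rw [realRoot_zero, mul_one]⟩

theorem IsRootTerm.exists_pow_eq_pow {a N : ℕ} {z : ℂ} (h : IsRootTerm a N z) :
    ∃ n j : ℕ, n ≠ 0 ∧ j ≤ n ∧ z ^ n = (a : ℂ) ^ j := by
  obtain ⟨ξ, m, j, hm, hξ, hj, rfl⟩ := h
  refine ⟨N * m, j * m, mul_ne_zero (by omega) hm.ne', Nat.mul_le_mul_right _ hj.le, ?_⟩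
  rw [mul_pow, mul_comm N m, pow_mul, hξ, one_pow, one_mul, mul_comm m N, pow_mul,
    realRoot_pow a (by omega), pow_mul]

/-- A nonzero algebraic integer has a conjugate of absolute value at least 1. Every conjugate of a
root term satisfies the same equation z^n = a^j with j ≤ n, hence is bounded by a. -/
theorem IsRootSum.le_mul {a N n : ℕ} (ha : a ≠ 0) {x : ℂ} (hx : x ≠ 0) (hint : IsIntegral ℤ x)
    {D : ℚ} (hD : 0 ≤ D) (h : IsRootSum a N n (D * x)) : (D : ℝ) ≤ n * a := by
  obtain ⟨z, hz, hsum⟩ := h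
  have halg : ∀ y ∈ insert x (Set.range z), IsIntegral ℚ y := by
    rintro y (rfl | ⟨i, rfl⟩)
    · exact hint.tower_top
    · obtain ⟨m, j, hm, -, hzm⟩ := (hz i).exists_pow_eq_pow
      refine IsIntegral.of_pow (Nat.pos_of_ne_zero hm) ?_
      rw [hzm]
      exact (isIntegral_natCast a).pow j
  set E := IntermediateField.adjoin ℚ (insert x (Set.range z)) with hE
  have hfd : FiniteDimensional ℚ E := IntermediateField.finiteDimensional_adjoin halg
  have : NumberField E := ⟨⟩
  let x' : E := ⟨x, IntermediateField.subset_adjoin _ _ (Set.mem_insert _ _)⟩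
  let z' : Fin n → E := fun i =>
    ⟨z i, IntermediateField.subset_adjoin _ _ (Set.mem_insert_of_mem _ ⟨i, rfl⟩)⟩
  have hint' : IsIntegral ℤ x' :=
    (isIntegral_algHom_iff (IsScalarTower.toAlgHom ℤ E ℂ) Subtype.val_injective).1 hint
  obtain ⟨σ, hσ⟩ : ∃ σ : E →+* ℂ, 1 ≤ ‖σ x'‖ :=
    NumberField.exists_conjugate_one_le_norm (α := (⟨x', hint'⟩ : NumberField.RingOfIntegers E))
      (fun h0 => hx (congrArg (fun y : NumberField.RingOfIntegers E => ((y : E) : ℂ)) h0))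
  have hsum' : ∑ i, z' i = D * x' := by
    apply Subtype.ext
    have : ((∑ i, z' i : E) : ℂ) = ∑ i, z i := by simp [z']
    rw [this, hsum]
    simp [x']
  have hbound : ∀ i, ‖σ (z' i)‖ ≤ a := by
    intro i
    obtain ⟨m, j, hm, hjm, hzm⟩ := (hz i).exists_pow_eq_pow
    have h1 : z' i ^ m = (a : E) ^ j := Subtype.ext (by simpa [z'] using hzm)
    have h2 : ‖σ (z' i)‖ ^ m = (a : ℝ) ^ j := by
      rw [← norm_pow, ← map_pow, h1, map_pow, map_natCast, norm_pow, Complex.norm_natCast]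
    have h3 : ‖σ (z' i)‖ ^ m ≤ (a : ℝ) ^ m := by
      rw [h2]
      exact pow_le_pow_right₀ (by exact_mod_cast Nat.one_le_iff_ne_zero.2 ha) hjm
    exact le_of_pow_le_pow_left₀ hm (Nat.cast_nonneg a) h3
  calc (D : ℝ) ≤ D * ‖σ x'‖ := le_mul_of_one_le_right (by exact_mod_cast hD) hσ
    _ = ‖σ (∑ i, z' i)‖ := by
      rw [hsum', map_mul, map_ratCast, norm_mul, Complex.norm_ratCast,
        abs_of_nonneg (by exact_mod_cast hD)]
    _ ≤ ∑ i, ‖σ (z' i)‖ := by rw [map_sum]; exact norm_sum_le _ _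
    _ ≤ ∑ _i : Fin n, (a : ℝ) := Finset.sum_le_sum fun i _ => hbound i
    _ = n * a := by simp

/-- The ring of integers of the N-th cyclotomic field is ℤ[ζ_N]. -/
theorem exists_isRootSum_of_mem_kummerField_one_left {N : ℕ} (hN : N ≠ 0) {x : ℂ}
    (hx : x ∈ kummerField 1 N) (hint : IsIntegral ℤ x) : ∃ n, IsRootSum 1 N n x := by
  have : NeZero N := ⟨hN⟩
  have hζ : IsPrimitiveRoot (stdRoot N) N := Complex.isPrimitiveRoot_exp N hN
  have hK : kummerField 1 N = IntermediateField.adjoin ℚ {stdRoot N} := by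
    apply le_antisymm
    · refine IntermediateField.adjoin_le_iff.2 fun z hz => ?_
      have hz' : z ^ N = 1 := by simpa using hz
      obtain ⟨i, -, rfl⟩ := hζ.eq_pow_of_pow_eq_one hz'
      exact pow_mem (IntermediateField.mem_adjoin_simple_self ℚ _) i
    · refine IntermediateField.adjoin_le_iff.2 ?_
      rintro _ rfl
      exact mem_kummerField_of_pow_eq_one one_ne_zero hN dvd_rfl hζ.pow_eq_one
  rw [hK] at hx
  have hcyc : IsCyclotomicExtension {N} ℚ (IntermediateField.adjoin ℚ {stdRoot N}) := by
    change IsCyclotomicExtension {N} ℚ (IntermediateField.adjoin ℚ {stdRoot N}).toSubalgebra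
    rw [IntermediateField.adjoin_simple_toSubalgebra_of_isAlgebraic
      (hζ.isIntegral (Nat.pos_of_ne_zero hN)).tower_top.isAlgebraic]
    exact hζ.adjoin_isCyclotomicExtension ℚ
  set E := IntermediateField.adjoin ℚ {stdRoot N} with hE
  let ζ' : E := ⟨stdRoot N, IntermediateField.mem_adjoin_simple_self ℚ _⟩
  have hζ' : IsPrimitiveRoot ζ' N :=
    IsPrimitiveRoot.of_map_of_injective (f := E.val) hζ Subtype.val_injective
  have hcl := IsCyclotomicExtension.Rat.isIntegralClosure_adjoin_singleton hζ'
  have hint' : IsIntegral ℤ (⟨x, hx⟩ : E) :=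
    (isIntegral_algHom_iff (IsScalarTower.toAlgHom ℤ E ℂ) Subtype.val_injective).1 hint
  obtain ⟨y, hy⟩ := hcl.isIntegral_iff.1 hint'
  have hyx : ((y : E) : ℂ) = x := congrArg Subtype.val hy
  rw [← hyx]
  obtain ⟨y, hy'⟩ := y
  rw [Algebra.adjoin_singleton_eq_range_aeval] at hy'
  obtain ⟨f, rfl⟩ := hy'
  have key : ∀ f : Polynomial ℤ, ∃ n, IsRootSum 1 N n (Polynomial.aeval (stdRoot N) f) := by
    intro f
    induction f using Polynomial.induction_on' with
    | add f g hf hg =>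
      obtain ⟨n, hn⟩ := hf
      obtain ⟨n', hn'⟩ := hg
      exact ⟨n + n', by rw [map_add]; exact hn.add hn'⟩
    | monomial i c =>
      have hterm : IsRootSum 1 N 1 (stdRoot N ^ i) := IsRootSum.of_isRootTerm
        (isRootTerm_of_pow_eq_one (Nat.pos_of_ne_zero hN) (Nat.pos_of_ne_zero hN)
          (by rw [← pow_mul, mul_comm, pow_mul, hζ.pow_eq_one, one_pow]))
      rw [Polynomial.aeval_monomial]
      have hnat : ∀ c : ℕ, IsRootSum 1 N c (c * stdRoot N ^ i) := fun c => by
        simpa using IsRootSum.sum (ι := Fin c) fun _ => hterm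
      rcases Int.eq_nat_or_neg c with ⟨c, rfl | rfl⟩
      · exact ⟨c, by simpa using hnat c⟩
      · exact ⟨c, by simpa using (hnat c).neg⟩
  obtain ⟨n, hn⟩ := key f
  refine ⟨n, ?_⟩
  convert hn
  exact (Polynomial.aeval_algHom_apply (IsScalarTower.toAlgHom ℤ E ℂ) ζ' f).symm

theorem exists_isRootSum_of_mem_kummerField_one_right {a : ℕ} {x : ℂ}
    (hx : x ∈ kummerField a 1) (hint : IsIntegral ℤ x) : ∃ n, IsRootSum a 1 n x := by
  have hbot : kummerField a 1 ≤ ⊥ := by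
    refine IntermediateField.adjoin_le_iff.2 fun z hz => ?_
    have hz' : z = a := by simpa using hz
    rw [hz']
    exact natCast_mem (⊥ : IntermediateField ℚ ℂ) a
  obtain ⟨r, rfl⟩ := IntermediateField.mem_bot.1 (hbot hx)
  have hr : IsIntegral ℤ r := (isIntegral_algHom_iff (IsScalarTower.toAlgHom ℤ ℚ ℂ)
    (algebraMap ℚ ℂ).injective).1 hint
  obtain ⟨c, rfl⟩ := IsIntegrallyClosed.isIntegral_iff.1 hr
  have hnat : ∀ c : ℕ, IsRootSum a 1 c (c : ℂ) := fun c => by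
    simpa using IsRootSum.sum (ι := Fin c) fun _ => IsRootSum.of_isRootTerm
      (isRootTerm_of_pow_eq_one (a := a) (N := 1) (m := 1) one_pos one_pos (one_pow 1))
  rcases Int.eq_nat_or_neg c with ⟨c, rfl | rfl⟩
  · exact ⟨c, by simpa using hnat c⟩
  · exact ⟨c, by simpa using (hnat c).neg⟩

/-! ### Lower bounds for Δ and the cancellation in Δr -/

theorem one_le_abs_norm {K : Type*} [Field K] [NumberField K] {x : K} (hx : x ≠ 0)
    (hint : IsIntegral ℤ x) : 1 ≤ |Algebra.norm ℚ x| := by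
  obtain ⟨n, hn⟩ := IsIntegrallyClosed.isIntegral_iff.1 (Algebra.isIntegral_norm ℚ hint)
  have h : Algebra.norm ℚ x ≠ 0 := Algebra.norm_ne_zero_iff.2 hx
  rw [← hn, algebraMap_int_eq, eq_intCast] at h ⊢
  rw [← Int.cast_abs]
  exact_mod_cast Int.one_le_abs (by exact_mod_cast h)

theorem abs_norm_intCast {K : Type*} [Field K] [NumberField K] (d : ℤ) :
    |Algebra.norm ℚ (d : K)| = (|d| : ℚ) ^ Module.finrank ℚ K := by
  have : (d : K) = algebraMap ℚ K d := by simp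
  rw [this, Algebra.norm_algebraMap, abs_pow]

section Delta

variable {a N : ℕ} [NeZero a]

theorem not_dvd_towerIndex_zero {q : ℕ} (hq : q.Prime) : ¬ q ∣ towerIndex N q 0 := by
  unfold towerIndex
  rw [pow_zero, one_mul, hq.prime.dvd_finsetProd_iff]
  rintro ⟨r, hr, h⟩
  obtain ⟨hr1, hr2⟩ := Finset.mem_filter.1 hr
  exact hr2.ne' ((Nat.prime_dvd_prime_iff_eq hq (Nat.prime_of_mem_primeFactors hr1)).1
    (hq.dvd_of_dvd_pow h))

theorem stepDisc_eq_intCast (q : N.primeFactors) (t : Fin (N.factorization q))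
    (ht : (t : ℕ) = 0) (hne : stepDisc a N q t ≠ 0) :
    stepDisc a N q t = ((kummerTraceMatrix a q).det : kummerField a (towerIndex N q t)) := by
  have hq := Nat.prime_of_mem_primeFactors q.2
  obtain ⟨t, htlt⟩ := t
  obtain rfl : t = 0 := ht
  unfold stepDisc at hne ⊢
  rw [if_pos rfl] at hne ⊢
  refine relDisc_eq_intCast (NeZero.ne a) ?_ hq (not_dvd_towerIndex_zero hq)
    (towerIndex_succ N q 0) _ ?_ ?_ hne
  · exact towerIndex_ne_zero q.2 (Nat.zero_le _)
  · have := Complex.isPrimitiveRoot_exp _ hq.ne_zero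
    simpa [stdRoot] using this
  · have := realRoot_one_pow (a := a) hq.ne_zero
    simpa using this

theorem isIntegral_stepDisc (q : N.primeFactors) (t : Fin (N.factorization q)) :
    IsIntegral ℤ (stepDisc a N q t) := by
  have hq := Nat.prime_of_mem_primeFactors q.2
  have := finiteDimensional_kummerField a (N := towerIndex N q ((t : ℕ) + 1))
    (towerIndex_ne_zero q.2 t.2)
  have hpos : 0 < (q : ℕ) ^ ((t : ℕ) + 1) := pow_pos hq.pos _
  refine isIntegral_relDisc _ ?_ ?_
  · refine IsIntegral.of_pow hpos ?_
    have : (⟨stdRoot ((q : ℕ) ^ ((t : ℕ) + 1)), mem_kummerField_of_pow_eq_one (NeZero.ne a)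
      (towerIndex_ne_zero q.2 t.2) (pow_dvd_towerIndex N q (t + 1)) (stdRoot_pow hpos.ne')⟩ :
      kummerField a (towerIndex N q ((t : ℕ) + 1))) ^ (q : ℕ) ^ ((t : ℕ) + 1) = 1 :=
      Subtype.ext (stdRoot_pow hpos.ne')
    rw [this]
    exact isIntegral_one
  · refine IsIntegral.of_pow hpos ?_
    have : (⟨realRoot a ((q : ℕ) ^ ((t : ℕ) + 1)) 1, mem_kummerField_of_pow_eq
      (towerIndex_ne_zero q.2 t.2) (pow_dvd_towerIndex N q (t + 1))
      (realRoot_one_pow hpos.ne')⟩ :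
      kummerField a (towerIndex N q ((t : ℕ) + 1))) ^ (q : ℕ) ^ ((t : ℕ) + 1) = (a : ℤ) :=
      Subtype.ext (by simpa using realRoot_one_pow hpos.ne')
    rw [this]
    exact isIntegral_algebraMap (x := (a : ℤ))

variable (a N) in
/-- The absolute norm of the discriminant of a step of the tower. -/
noncomputable def stepNorm (q : N.primeFactors) (t : Fin (N.factorization q)) : ℚ :=
  |Algebra.norm ℚ (IntermediateField.inclusion
    (kummerField_le (Nat.mem_primeFactors.1 q.2).2.2 (towerIndex_dvd q.2 t.2.le))
      (stepDisc a N q t))|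

theorem kummerDelta_eq_prod (ha : a ≠ 1) :
    kummerDelta a N = ∏ q : N.primeFactors, ∏ t : Fin (N.factorization q), stepNorm a N q t := by
  unfold kummerDelta
  rw [if_neg ha]
  simp only [map_prod, Finset.abs_prod]
  rfl

theorem stepDisc_ne_zero_of_stepNorm_ne_zero {q : N.primeFactors} {t : Fin (N.factorization q)}
    (h : stepNorm a N q t ≠ 0) : stepDisc a N q t ≠ 0 := by
  have := finiteDimensional_kummerField a (Nat.mem_primeFactors.1 q.2).2.2
  intro h0
  apply h
  unfold stepNorm
  rw [h0, map_zero, Algebra.norm_zero, abs_zero]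

theorem one_le_stepNorm {q : N.primeFactors} {t : Fin (N.factorization q)}
    (h : stepNorm a N q t ≠ 0) : 1 ≤ stepNorm a N q t := by
  have := finiteDimensional_kummerField a (Nat.mem_primeFactors.1 q.2).2.2
  have : NumberField (kummerField a N) := ⟨⟩
  refine one_le_abs_norm ?_ ?_
  · exact (map_ne_zero _).2 (stepDisc_ne_zero_of_stepNorm_ne_zero h)
  · exact (isIntegral_stepDisc q t).map (IntermediateField.inclusion
      (kummerField_le (Nat.mem_primeFactors.1 q.2).2.2 (towerIndex_dvd q.2 t.2.le)))

theorem stepNorm_eq_pow {q : N.primeFactors} {t : Fin (N.factorization q)} (ht : (t : ℕ) = 0)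
    (h : stepNorm a N q t ≠ 0) : stepNorm a N q t =
      (|(kummerTraceMatrix a q).det| : ℚ) ^ Module.finrank ℚ (kummerField a N) := by
  have := finiteDimensional_kummerField a (Nat.mem_primeFactors.1 q.2).2.2
  have : NumberField (kummerField a N) := ⟨⟩
  unfold stepNorm
  rw [stepDisc_eq_intCast q t ht (stepDisc_ne_zero_of_stepNorm_ne_zero h), map_intCast,
    abs_norm_intCast]

theorem four_mul_pow_le_stepNorm {q : N.primeFactors} {t : Fin (N.factorization q)}
    (ht : (t : ℕ) = 0) (h : stepNorm a N q t ≠ 0) :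
    (4 * (a : ℚ)) ^ Module.finrank ℚ (kummerField a N) ≤ stepNorm a N q t := by
  have := finiteDimensional_kummerField a (Nat.mem_primeFactors.1 q.2).2.2
  have hq := Nat.prime_of_mem_primeFactors q.2
  have e := stepNorm_eq_pow ht h
  have hdet : (kummerTraceMatrix a q).det ≠ 0 := by
    intro h0
    rw [h0, Int.cast_zero, abs_zero, zero_pow Module.finrank_pos.ne'] at e
    exact h e
  rw [e]
  have := four_mul_le_abs_det_kummerTraceMatrix (Nat.pos_of_ne_zero (NeZero.ne a)) hq.one_lt hdet
  gcongr
  exact_mod_cast this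

end Delta

section Scale

variable {a p N₁ : ℕ} [NeZero a] (ha : a ≠ 1) (hp : p.Prime) (hpN : ¬ p ∣ N₁)
  (hN : p * N₁ ≠ 0) {ζ ρ : ℂ} (hζ : IsPrimitiveRoot ζ p) (hρ : ρ ^ p = (a : ℂ))
include ha hp hpN

theorem kummerScale_eq_and_le_finrank (hr : kummerScale a p N₁ hN ζ ρ hζ hρ ≠ 0) :
    kummerScale a p N₁ hN ζ ρ hζ hρ =
      1 / (|(kummerTraceMatrix a p).det| : ℚ) ^ Module.finrank ℚ (kummerField a (p * N₁)) ∧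
    (p - 1) * p ≤ Module.finrank ℚ (kummerField a (p * N₁)) := by
  have := finiteDimensional_kummerField a hN
  have : NumberField (kummerField a (p * N₁)) := ⟨⟩
  unfold kummerScale at hr ⊢
  rw [if_neg ha] at hr ⊢
  have hne : relDisc (kummerField a N₁) (kummerField a (p * N₁))
        (kummerField_le hN (Dvd.intro_left p rfl)) (p - 1) p
        ⟨ζ, mem_kummerField_of_pow_eq_one (NeZero.ne a) hN (Dvd.intro N₁ rfl) hζ.pow_eq_one⟩
        ⟨ρ, mem_kummerField_of_pow_eq hN (Dvd.intro N₁ rfl) hρ⟩ ≠ 0 := by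
    intro h0
    rw [h0, map_zero, Algebra.norm_zero, abs_zero, div_zero] at hr
    exact hr rfl
  refine ⟨?_, card_le_finrank_of_relDisc_ne_zero _ hne⟩
  rw [relDisc_eq_intCast (NeZero.ne a) (right_ne_zero_of_mul hN) hp hpN rfl _ hζ hρ hne,
    map_intCast, abs_norm_intCast]

/-- As p divides N exactly once, the tower has a single step at p. Its norm is the same power of the
same determinant that r inverts. -/
theorem kummerDelta_mul_kummerScale (hΔ : kummerDelta a (p * N₁) ≠ 0)
    (hr : kummerScale a p N₁ hN ζ ρ hζ hρ ≠ 0) :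
    kummerDelta a (p * N₁) * kummerScale a p N₁ hN ζ ρ hζ hρ =
      ∏ q ∈ Finset.univ.erase (⟨p, Nat.mem_primeFactors.2 ⟨hp, Dvd.intro N₁ rfl, hN⟩⟩ :
        (p * N₁).primeFactors), ∏ t, stepNorm a (p * N₁) q t := by
  set P : (p * N₁).primeFactors := ⟨p, Nat.mem_primeFactors.2 ⟨hp, Dvd.intro N₁ rfl, hN⟩⟩
  have hfac : (p * N₁).factorization P = 1 := by
    have h1 : (p * N₁).factorization p = 1 := by
      rw [Nat.factorization_mul hp.ne_zero (right_ne_zero_of_mul hN), Finsupp.add_apply,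
        hp.factorization_self, Nat.factorization_eq_zero_of_not_dvd hpN]
    exact h1
  have hsub : Subsingleton (Fin ((p * N₁).factorization P)) := by rw [hfac]; infer_instance
  let t₀ : Fin ((p * N₁).factorization P) := ⟨0, by rw [hfac]; exact one_pos⟩
  rw [(kummerScale_eq_and_le_finrank ha hp hpN hN hζ hρ hr).1, kummerDelta_eq_prod ha] at *
  have hne : stepNorm a (p * N₁) P t₀ ≠ 0 :=
    Finset.prod_ne_zero_iff.1 (Finset.prod_ne_zero_iff.1 hΔ P (Finset.mem_univ _)) t₀
      (Finset.mem_univ _)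
  have hP : ∏ t, stepNorm a (p * N₁) P t =
      (|(kummerTraceMatrix a p).det| : ℚ) ^ Module.finrank ℚ (kummerField a (p * N₁)) := by
    rw [Fintype.prod_subsingleton _ t₀]
    exact stepNorm_eq_pow rfl hne
  rw [← Finset.mul_prod_erase _ _ (Finset.mem_univ P), hP]
  have : (|(kummerTraceMatrix a p).det| : ℚ) ^ Module.finrank ℚ (kummerField a (p * N₁)) ≠ 0 := by
    rw [← hP, Fintype.prod_subsingleton _ t₀]
    exact hne
  field_simp

theorem kummerDelta_mul_kummerScale_of_eq_one (h1 : N₁ = 1) (hΔ : kummerDelta a (p * N₁) ≠ 0)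
    (hr : kummerScale a p N₁ hN ζ ρ hζ hρ ≠ 0) :
    kummerDelta a (p * N₁) * kummerScale a p N₁ hN ζ ρ hζ hρ = 1 := by
  rw [kummerDelta_mul_kummerScale ha hp hpN hN hζ hρ hΔ hr]
  refine Finset.prod_eq_one fun q hq => absurd ?_ (Finset.ne_of_mem_erase hq)
  have h := Nat.mem_primeFactors.1 q.2
  have hdvd : (q : ℕ) ∣ p := by simpa [h1] using h.2.1
  exact Subtype.ext ((Nat.prime_dvd_prime_iff_eq h.1 hp).1 hdvd)

/-- A prime dividing N₁ gives a first step of norm at least (4a)^[ℚ_a(N):ℚ], and all other step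
norms are at least 1. The degree is at least p(p-1), because r ≠ 0 forces linear independence of the
family in its discriminant. -/
theorem four_mul_pow_le_kummerDelta_mul_kummerScale (h1 : N₁ ≠ 1)
    (hΔ : kummerDelta a (p * N₁) ≠ 0) (hr : kummerScale a p N₁ hN ζ ρ hζ hρ ≠ 0) :
    (4 * (a : ℚ)) ^ ((p - 1) * p) ≤
      kummerDelta a (p * N₁) * kummerScale a p N₁ hN ζ ρ hζ hρ := by
  rw [kummerDelta_mul_kummerScale ha hp hpN hN hζ hρ hΔ hr]
  have hle := (kummerScale_eq_and_le_finrank ha hp hpN hN hζ hρ hr).2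
  rw [kummerDelta_eq_prod ha] at hΔ
  have hne : ∀ q t, stepNorm a (p * N₁) q t ≠ 0 := fun q t =>
    Finset.prod_ne_zero_iff.1 (Finset.prod_ne_zero_iff.1 hΔ q (Finset.mem_univ _)) t
      (Finset.mem_univ _)
  obtain ⟨r, hr, hrN⟩ := Nat.exists_prime_and_dvd h1
  have hrmem : r ∈ (p * N₁).primeFactors :=
    Nat.mem_primeFactors.2 ⟨hr, dvd_mul_of_dvd_right hrN p, hN⟩
  let R : (p * N₁).primeFactors := ⟨r, hrmem⟩
  let t₀ : Fin ((p * N₁).factorization R) :=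
    ⟨0, hr.factorization_pos_of_dvd hN (dvd_mul_of_dvd_right hrN p)⟩
  have ha1 : (1 : ℚ) ≤ 4 * a := by
    have : (1 : ℚ) ≤ a := by exact_mod_cast Nat.one_le_iff_ne_zero.2 (NeZero.ne a)
    linarith
  have hone : ∀ q, 1 ≤ ∏ t, stepNorm a (p * N₁) q t := fun q =>
    Finset.one_le_prod fun t _ => one_le_stepNorm (hne q t)
  calc (4 * (a : ℚ)) ^ ((p - 1) * p)
      ≤ (4 * (a : ℚ)) ^ Module.finrank ℚ (kummerField a (p * N₁)) := pow_le_pow_right₀ ha1 hle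
    _ ≤ stepNorm a (p * N₁) R t₀ := four_mul_pow_le_stepNorm rfl (hne _ _)
    _ = ∏ t ∈ {t₀}, stepNorm a (p * N₁) R t := (Finset.prod_singleton _ _).symm
    _ ≤ ∏ t, stepNorm a (p * N₁) R t :=
      Finset.prod_le_prod_of_subset_of_one_le (Finset.subset_univ _)
        (fun t _ => abs_nonneg _) fun t _ _ => one_le_stepNorm (hne R t)
    _ = ∏ q ∈ {R}, ∏ t, stepNorm a (p * N₁) q t := (Finset.prod_singleton _ _).symm
    _ ≤ _ := by
      refine Finset.prod_le_prod_of_subset_of_one_le ?_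
        (fun q _ => zero_le_one.trans (hone q)) fun q _ _ => hone q
      rw [Finset.singleton_subset_iff, Finset.mem_erase]
      refine ⟨fun h => hpN ?_, Finset.mem_univ _⟩
      have : r = p := congrArg Subtype.val h
      rwa [← this]

end Scale

theorem kummerDelta_one_left (N : ℕ) : kummerDelta 1 N = 1 := by
  unfold kummerDelta
  rw [if_pos rfl]

theorem kummerDelta_one_right (a : ℕ) [NeZero a] : kummerDelta a 1 = 1 := by
  by_cases ha : a = 1
  · unfold kummerDelta
    rw [if_pos ha]
  · have : IsEmpty (1 : ℕ).primeFactors :=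
      ⟨fun x => by simpa using x.2⟩
    rw [kummerDelta_eq_prod ha, Fintype.prod_empty]

theorem IsRootTerm.mul_pow_mul_pow_one_left {p N₁ : ℕ} (hN : p * N₁ ≠ 0) {ζ ρ z : ℂ}
    (hζ : ζ ^ p = 1) (hρ : ρ ^ p = ((1 : ℕ) : ℂ)) (i j : ℕ) (hz : IsRootTerm 1 N₁ z) :
    IsRootTerm 1 (p * N₁) (z * (ζ ^ i * ρ ^ j)) := by
  obtain ⟨ξ, m, l, hm, hξ, -, rfl⟩ := hz
  have hp : p ≠ 0 := left_ne_zero_of_mul hN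
  refine isRootTerm_of_pow_eq_one (m := m * p) (Nat.pos_of_ne_zero hN)
    (Nat.mul_pos hm (Nat.pos_of_ne_zero hp)) ?_
  rw [realRoot_one_left, mul_one, mul_pow, pow_mul, hξ, one_pow, one_mul, mul_pow,
    ← pow_mul, ← pow_mul, show i * (m * p) = p * (i * m) by ring,
    show j * (m * p) = p * (j * m) by ring, pow_mul ζ, pow_mul ρ, hζ, hρ]
  simp

/-- An arbitrary p-th root ρ of a differs from the positive one by a p-th root of unity. -/
theorem IsRootTerm.mul_pow_mul_pow_one_right {a p : ℕ} (ha : a ≠ 0) (hp : p ≠ 0) {ζ ρ z : ℂ}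
    (hζ : ζ ^ p = 1) (hρ : ρ ^ p = (a : ℂ)) (i : ℕ) {j : ℕ} (hj : j < p)
    (hz : IsRootTerm a 1 z) : IsRootTerm a (p * 1) (z * (ζ ^ i * ρ ^ j)) := by
  obtain ⟨ξ, m, l, hm, hξ, hl, rfl⟩ := hz
  obtain rfl : l = 0 := by omega
  have hr : realRoot a p 1 ^ p = (a : ℂ) := realRoot_one_pow hp
  have ha' : (a : ℂ) ≠ 0 := by exact_mod_cast ha
  have hr0 : realRoot a p 1 ≠ 0 := by
    intro h
    rw [h, zero_pow hp] at hr
    exact ha' hr.symm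
  have hrj : realRoot a p j = realRoot a p 1 ^ j := by
    unfold realRoot
    rw [← Complex.ofReal_pow, ← Real.rpow_natCast, ← Real.rpow_mul (Nat.cast_nonneg a)]
    congr 2
    push_cast; ring
  refine ⟨ξ * ζ ^ i * (ρ / realRoot a p 1) ^ j, m * p, j,
    Nat.mul_pos hm (Nat.pos_of_ne_zero hp), ?_, by omega, ?_⟩
  · have h1 : (ρ / realRoot a p 1) ^ p = 1 := by rw [div_pow, hρ, hr, div_self ha']
    rw [mul_pow, mul_pow, pow_mul, hξ, one_pow, one_mul, ← pow_mul, ← pow_mul,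
      show i * (m * p) = p * (i * m) by ring, show j * (m * p) = p * (j * m) by ring,
      pow_mul ζ, pow_mul (ρ / _), hζ, h1, one_pow, one_pow, mul_one]
  · rw [realRoot_zero, mul_one p, hrj, div_pow]
    field_simp

/-! ### The theorem -/

theorem theorem4p4 (k : ℝ) (hk : Real.log 2 < k) (c₁ : ℝ) (hc₁ : IsLoxtonConst k c₁) :
    ∃ c₅ : ℝ, 0 < c₅ ∧
      ∀ (a : ℕ) [NeZero a],
        (a = 1 ∨ ∀ (b : ℚ) (m : ℕ), 2 ≤ m → (a : ℚ) ≠ b ^ m) →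
      ∀ (p N₁ : ℕ) (_ : p.Prime) (_ : ¬ p ∣ N₁) (hN : p * N₁ ≠ 0), c₅ ≤ (p : ℝ) →
      ∀ (ζ ρ : ℂ) (hζ : IsPrimitiveRoot ζ p) (hρ : ρ ^ p = (a : ℂ))
        (α : Fin p → Fin p → ℂ),
        (∀ i j, α i j ∈ kummerField a N₁ ∧ IsIntegral ℤ (α i j)) →
      ∀ β : ℂ,
        β = ∑ i : Fin p, ∑ j : Fin p,
          (α i j * ((kummerScale a p N₁ hN ζ ρ hζ hρ : ℚ) : ℂ)) *
            ζ ^ (i : ℕ) * ρ ^ (j : ℕ) →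
        Real.log (kummerLength a (p * N₁) β : ℝ) ≤ (p : ℝ) * ((p : ℝ) - 1) →
        2 * (p : ℝ) * ((p : ℝ) - 1) * loxtonG k c₁ (kummerLength a (p * N₁) β : ℝ) ≤
          ∑ i : Fin p, ∑ j : Fin p, ∑ l : Fin p, ∑ m : Fin p,
            loxtonG k c₁ (kummerLength a N₁ (α i j - α l m) : ℝ) := by
  obtain ⟨c₅, hc₅, hbound⟩ := exists_loxtonG_sum_bound hk hc₁
  refine ⟨c₅, hc₅, ?_⟩
  intro a _ _ p N₁ hp hpN hN hpc ζ ρ hζ hρ α hα β hβ hlog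
  set r := kummerScale a p N₁ hN ζ ρ hζ hρ with hr
  set Δ := kummerDelta a (p * N₁) with hΔ
  -- Since `Real.log 0 = 0`, the hypothesis on log M also admits M = 0.
  by_cases hT : kummerLength a (p * N₁) β = 0
  · rw [hT, Nat.cast_zero, loxtonG_zero, mul_zero]
    exact Finset.sum_nonneg fun i _ => Finset.sum_nonneg fun j _ => Finset.sum_nonneg fun l _ =>
      Finset.sum_nonneg fun m _ => loxtonG_nonneg (Nat.cast_nonneg _)
  have ha0 : a ≠ 0 := NeZero.ne a
  set β' := ∑ s : Fin p × Fin p, α s.1 s.2 * (ζ ^ (s.1 : ℕ) * ρ ^ (s.2 : ℕ)) with hβ'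
  have hββ' : β = r * β' := by
    rw [hβ, hβ', Fintype.sum_prod_type, Finset.mul_sum]
    refine Finset.sum_congr rfl fun i _ => ?_
    rw [Finset.mul_sum]
    exact Finset.sum_congr rfl fun j _ => by ring
  have hΔβ : (Δ : ℂ) * β = ((Δ * r : ℚ) : ℂ) * β' := by rw [hββ']; push_cast; ring
  have hne : ((Δ * r : ℚ) : ℂ) * β' ≠ 0 := fun h =>
    hT (kummerLength_eq_zero_of_mul_eq_zero (by rw [← hΔ, hΔβ, h]))
  have hβ0 : β' ≠ 0 := right_ne_zero_of_mul hne
  have hΔr : Δ * r ≠ 0 := by exact_mod_cast left_ne_zero_of_mul hne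
  have hΔ0 : Δ ≠ 0 := left_ne_zero_of_mul hΔr
  have hr0 : r ≠ 0 := right_ne_zero_of_mul hΔr
  -- Here (4a)^(p(p-1)) ≤ Δr ≤ aT contradicts T ≤ e^(p(p-1)), because e < 4.
  by_cases hcase : a ≠ 1 ∧ N₁ ≠ 1
  · exfalso
    obtain ⟨ha1, hN1⟩ := hcase
    have hβint : IsIntegral ℤ β' := by
      refine IsIntegral.sum _ fun s _ => ((hα _ _).2).mul (IsIntegral.mul ?_ ?_)
      · exact (hζ.isIntegral hp.pos).pow _
      · exact (IsIntegral.of_pow hp.pos (by rw [hρ]; exact isIntegral_natCast a)).pow _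
    have hge : (4 * (a : ℚ)) ^ ((p - 1) * p) ≤ Δ * r :=
      four_mul_pow_le_kummerDelta_mul_kummerScale ha1 hp hpN hN hζ hρ hN1 hΔ0 hr0
    have hrep := isRootSum_of_kummerLength_ne_zero hT
    rw [← hΔ, hΔβ] at hrep
    have hle := hrep.le_mul ha0 hβ0 hβint (le_trans (by positivity) hge)
    have hge' : (4 * (a : ℝ)) ^ ((p - 1) * p) ≤ ((Δ * r : ℚ) : ℝ) := by exact_mod_cast hge
    have hn0 : (p - 1) * p ≠ 0 :=
      mul_ne_zero (Nat.sub_ne_zero_of_lt hp.one_lt) hp.ne_zero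
    have hT' : (kummerLength a (p * N₁) β : ℝ) < 4 ^ ((p - 1) * p) := by
      have hpos : (0 : ℝ) < kummerLength a (p * N₁) β := by
        exact_mod_cast Nat.pos_of_ne_zero hT
      have h1 := (Real.log_le_iff_le_exp hpos).1 hlog
      have h2 : (p : ℝ) * ((p : ℝ) - 1) = ((p - 1) * p : ℕ) * 1 := by
        rw [Nat.cast_mul, Nat.cast_sub hp.one_le]; push_cast; ring
      rw [h2, Real.exp_nat_mul] at h1
      exact h1.trans_lt (pow_lt_pow_left₀ (Real.exp_one_lt_d9.trans (by norm_num))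
        (Real.exp_pos 1).le hn0)
    have ha1' : (1 : ℝ) ≤ a := by exact_mod_cast Nat.one_le_iff_ne_zero.2 ha0
    have : (kummerLength a (p * N₁) β : ℝ) * a < (4 * (a : ℝ)) ^ ((p - 1) * p) := by
      rw [mul_pow]
      exact mul_lt_mul hT' (le_self_pow₀ ha1' hn0) (by linarith) (by positivity)
    linarith
  have hcase' : a = 1 ∨ N₁ = 1 := by tauto
  have hΔ1 : kummerDelta a N₁ = 1 := by
    rcases hcase' with h | h <;> subst h
    · exact kummerDelta_one_left N₁
    · exact kummerDelta_one_right a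
  have hΔr1 : Δ * r = 1 := by
    by_cases ha1 : a = 1
    · have h1 : Δ = 1 := by rw [hΔ]; unfold kummerDelta; rw [if_pos ha1]
      have h2 : r = 1 := by rw [hr]; unfold kummerScale; rw [if_pos ha1]
      rw [h1, h2, one_mul]
    · exact kummerDelta_mul_kummerScale_of_eq_one ha1 hp hpN hN hζ hρ
        (hcase'.resolve_left ha1) hΔ0 hr0
  have hx : ∀ s : Fin p × Fin p, ∃ n, IsRootSum a N₁ n (α s.1 s.2) := by
    intro s
    obtain ⟨h1, h2⟩ := hα s.1 s.2
    rcases hcase' with h | h <;> subst h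
    · exact exists_isRootSum_of_mem_kummerField_one_left (right_ne_zero_of_mul hN) h1 h2
    · exact exists_isRootSum_of_mem_kummerField_one_right h1 h2
  have hw : ∀ (s : Fin p × Fin p) (z : ℂ), IsRootTerm a N₁ z →
      IsRootTerm a (p * N₁) (z * (ζ ^ (s.1 : ℕ) * ρ ^ (s.2 : ℕ))) := by
    intro s z hz
    rcases hcase' with h | h <;> subst h
    · exact hz.mul_pow_mul_pow_one_left hN hζ.pow_eq_one hρ _ _
    · exact hz.mul_pow_mul_pow_one_right ha0 hp.ne_zero hζ.pow_eq_one hρ _ s.2.2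
  -- The sum over all i < p, including i = p - 1, contains the vanishing factor 1 + ζ + ⋯ + ζ^(p-1).
  have hw0 : ∑ s : Fin p × Fin p, ζ ^ (s.1 : ℕ) * ρ ^ (s.2 : ℕ) = 0 := by
    rw [Fintype.sum_prod_type]
    simp only [← Finset.mul_sum, ← Finset.sum_mul]
    rw [Fin.sum_univ_eq_sum_range (fun i => ζ ^ i), hζ.geom_sum_eq_zero hp.one_lt, zero_mul]
  obtain ⟨hsymm, htri, hlen⟩ := kummerLength_le_sum hΔ1 hx hw hw0 (β := β)
    (by rw [← hΔ, hΔβ, hΔr1, Rat.cast_one, one_mul])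
  have main := hbound p hpc _ hsymm htri _ hlen hlog
  simpa only [Fintype.sum_prod_type] using main
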